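/- Let $n\ge 2$ and $[n]=\{1,\dots,n\}$. Let $X(n)$ be the simplicial complex whose vertices are the proper non-empty subsets of $[n]$ and whose $q$-faces are the sets $\{x_0,\dots,x_q\}$ of $q+1$ pairwise disjoint vertices. Order the vertices by decreasing size and, within a given size, lexicographically. Orient each face by writing it $x_0x_1\dots x_q$ in increasing order. Let $C_*$ be the augmented oriented simplicial chain complex of $X(n)$ over $\mathbb Z$. The symmetric group $S_n$ acts on $C_*$ by chain maps: $g\cdot x_0\dots x_q=\operatorname{sgn}(\pi)\,y_0\dots y_q$, where $y_0\dots y_q$ is the oriented face $\{gx_0,\dots,gx_q\}$ and $gx_i=y_{\pi(i)}$. So $S_n$ acts on $\widetilde H_q(X(n),\mathbb Z)$ for all $q\ge 0$. The facets (maximal faces) of $X(n)$ are the partitions of the set $[n]$ into proper non-empty blocks. The shape of a facet is the partition of the number $n$ formed by its block sizes. Fix a total order of the facets in which facets with more singleton blocks come first. A facet $\sigma$ is a homology facet if for every $x\in\sigma$ the set $\sigma\setminus\{x\}$ is contained in a facet that comes before $\sigma$. The class in $\widetilde H_q(X(n),\mathbb Z)$ corresponding to a $q$-dimensional homology facet $\sigma$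 is the class of a $q$-cycle whose coefficient is $1$ at the oriented face $\sigma$ and $0$ at every other $q$-dimensional homology facet. For a partition $\lambda=(\lambda_0\ge\dots\ge\lambda_q)$ of $n$ with no part equal to $1$ or $n$, let $V(\lambda)\subseteq\widetilde H_q(X(n),\mathbb Z)$ be the subgroup spanned by the classes corresponding to the homology facets of shape $\lambda$. For a partition $\lambda=(\lambda_0\ge\dots\ge\lambda_q)$ of $n$, let $S_\lambda\le S_n$ be the standard Young subgroup preserving each of the consecutive intervals $x_0,\dots,x_q$ of $[n]$ of lengths $\lambda_0,\dots,\lambda_q$, and let $N_\lambda=N_{S_n}(S_\lambda)$. Each $g\in N_\lambda$ permutes the intervals, $g x_i=x_{\bar g i}$, and $g\mapsto\bar g$ has kernel $S_\lambda$. Let $V=\mathbb Z v$ be the rank-one $N_\lambda$-module with $g\cdot v=\operatorname{sgn}(\bar g)\,v$, and let $V{\uparrow}_{N_\lambda}^{S_n}$ be the induced $\mathbb ZS_n$-module. **Theorem.** 1. For every partition $\lambda\neq(n)$ of $n$, with $q+1$ parts, the subgroup of $C_q$ spanned by the oriented facets of shape $\lambda$ is a $\mathbb ZS_n$-submodule,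 and it is isomorphic to $V{\uparrow}_{N_\lambda}^{S_n}$ as a $\mathbb ZS_n$-module. 2. For every $q\ge 0$ and every partition $\lambda$ of $n$ of length $q+1$ with no part equal to $1$ or $n$, $V(\lambda)$ is a $\mathbb ZS_n$-submodule of $\widetilde H_q(X(n),\mathbb Z)$, and $V(\lambda)\cong V{\uparrow}_{N_\lambda}^{S_n}$ as $\mathbb ZS_n$-modules. 3. For every $q\ge 0$, $\widetilde H_q(X(n),\mathbb Z)$ is the internal direct sum of the submodules $V(\lambda)$, and hence $$\widetilde H_q(X(n),\mathbb Z)\;\cong\;\bigoplus_\lambda V{\uparrow}_{N_\lambda}^{S_n}$$ as $\mathbb ZS_n$-modules, where both sums are over all partitions $\lambda$ of $n$ of length $q+1$ with no parts equal to $1$ or $n$. -/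

import Mathlib

open scoped Pointwise

noncomputable section

/-! ### Oriented simplicial chains

`V` is a totally ordered set of vertices.  A finite set `s ⊆ V` is oriented by listing its elements
in increasing order, so `Finset V →₀ ℤ` is the free abelian group on all oriented simplices with
vertices in `V` (including the empty simplex, in degree `-1`). -/

namespace OrientedChain

variable {V : Type*} [LinearOrder V]

/-- The differential `x₀x₁…x_q ↦ ∑ᵢ (-1)ⁱ x₀…x̂ᵢ…x_q`; the index `i` of a vertex `x` of `s` is the
number of vertices of `s` smaller than `x`. In degree `0` it is the augmentation `x₀ ↦ ∅`. -/
def boundary (V : Type*) [LinearOrder V] : (Finset V →₀ ℤ) →ₗ[ℤ] (Finset V →₀ ℤ) :=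
  Finsupp.linearCombination ℤ fun s : Finset V =>
    ∑ x ∈ s, Finsupp.single (s.erase x) ((-1 : ℤ) ^ (s.filter fun y => y < x).card)

lemma boundary_single (s : Finset V) (a : ℤ) :
    boundary V (Finsupp.single s a) =
      a • ∑ x ∈ s, Finsupp.single (s.erase x) ((-1 : ℤ) ^ (s.filter fun y => y < x).card) := by
  simp [boundary]

variable {G : Type*} [Group G] [MulAction G V]

/-- The sign of the permutation `π` with `(g x₀)(g x₁)…(g x_q) = y_{π 0} y_{π 1} … y_{π q}`, where
`s = x₀x₁…x_q` and `g • s = y₀y₁…y_q` are listed in increasing order: it is `(-1)` to the number of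
inversions of `π`. -/
def orientationSign (g : G) (s : Finset V) : ℤ :=
  (-1) ^ ((s ×ˢ s).filter fun p : V × V => p.1 < p.2 ∧ g • p.2 < g • p.1).card

def pairSign (g : G) (x y : V) : ℤ := if (x < y ↔ g • x < g • y) then 1 else -1

lemma orientationSign_eq_prod (g : G) (s : Finset V) :
    orientationSign g s =
      ∏ x ∈ s, ∏ y ∈ s, if x < y ∧ g • y < g • x then (-1 : ℤ) else 1 := by
  rw [orientationSign, ← Finset.prod_product', Finset.prod_ite]
  simp

lemma orientationSign_insert (g : G) {a : V} {s : Finset V} (ha : a ∉ s) :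
    orientationSign g (insert a s) = orientationSign g s * ∏ y ∈ s, pairSign g a y := by
  simp only [orientationSign_eq_prod, Finset.prod_insert ha, Finset.prod_mul_distrib, lt_irrefl,
    false_and, if_false, one_mul]
  rw [mul_comm (∏ y ∈ s, _), mul_comm _ (∏ x ∈ s, ∏ y ∈ s, _), mul_right_comm, mul_assoc,
    ← Finset.prod_mul_distrib]
  congr 1
  refine Finset.prod_congr rfl fun y hy => ?_
  have hne : a ≠ y := fun h => ha (h ▸ hy)
  have hne' : g • a ≠ g • y := fun h => hne (MulAction.injective g h)
  unfold pairSign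
  rcases lt_or_gt_of_ne hne with h | h <;> rcases lt_or_gt_of_ne hne' with h' | h' <;>
    simp [h, h', h.not_gt, h'.not_gt]

lemma orientationSign_one (s : Finset V) : orientationSign (1 : G) s = 1 := by
  have : ((s ×ˢ s).filter fun p : V × V => p.1 < p.2 ∧ (1 : G) • p.2 < (1 : G) • p.1) = ∅ := by
    refine Finset.filter_eq_empty_iff.2 fun p _ h => ?_
    rw [one_smul, one_smul] at h
    exact h.1.not_gt h.2
  rw [orientationSign, this]
  simp

lemma orientationSign_mul (g h : G) (s : Finset V) :
    orientationSign (g * h) s = orientationSign g (h • s) * orientationSign h s := by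
  induction s using Finset.induction_on with
  | empty => simp [orientationSign]
  | insert a s ha ih =>
    have ha' : h • a ∉ h • s := by simpa [Finset.smul_mem_smul_finset_iff] using ha
    have hp : ∏ y ∈ h • s, pairSign g (h • a) y = ∏ y ∈ s, pairSign g (h • a) (h • y) :=
      Finset.prod_image fun x _ y _ hxy => MulAction.injective h hxy
    have hq : ∏ y ∈ s, pairSign (g * h) a y =
        (∏ y ∈ s, pairSign g (h • a) (h • y)) * ∏ y ∈ s, pairSign h a y := by
      rw [← Finset.prod_mul_distrib]
      refine Finset.prod_congr rfl fun y _ => ?_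
      simp only [pairSign, mul_smul]
      by_cases h1 : a < y <;> by_cases h2 : h • a < h • y <;>
        by_cases h3 : g • h • a < g • h • y <;> simp [h1, h2, h3]
    have hs : h • insert a s = insert (h • a) (h • s) := by
      simp [Finset.smul_finset_def, Finset.image_insert]
    rw [orientationSign_insert _ ha, hs, orientationSign_insert _ ha', orientationSign_insert _ ha,
      ih, hp, hq]
    ring

lemma neg_one_pow_card {W : Type*} (s : Finset W) (p : W → Prop) [DecidablePred p] :
    (-1 : ℤ) ^ (s.filter p).card = ∏ y ∈ s, if p y then (-1 : ℤ) else 1 := by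
  rw [Finset.prod_ite]
  simp

lemma orientationSign_erase (g : G) {x : V} {s : Finset V} (hx : x ∈ s) :
    orientationSign g s * (-1 : ℤ) ^ ((g • s).filter fun y => y < g • x).card =
      (-1 : ℤ) ^ (s.filter fun y => y < x).card * orientationSign g (s.erase x) := by
  obtain ⟨t, hxt, rfl⟩ : ∃ t, x ∉ t ∧ insert x t = s :=
    ⟨s.erase x, Finset.notMem_erase x s, Finset.insert_erase hx⟩
  have h1 : (-1 : ℤ) ^ ((g • insert x t).filter fun y => y < g • x).card =
      ∏ y ∈ t, if g • y < g • x then (-1 : ℤ) else 1 := by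
    rw [neg_one_pow_card, Finset.smul_finset_def,
      Finset.prod_image fun x _ y _ hxy => MulAction.injective g hxy, Finset.prod_insert hxt]
    simp
  have h2 : (∏ y ∈ t, pairSign g x y) * (∏ y ∈ t, if g • y < g • x then (-1 : ℤ) else 1) =
      ∏ y ∈ t, if y < x then (-1 : ℤ) else 1 := by
    rw [← Finset.prod_mul_distrib]
    refine Finset.prod_congr rfl fun y hy => ?_
    have hne : x ≠ y := fun h => hxt (h ▸ hy)
    have hne' : g • x ≠ g • y := fun h => hne (MulAction.injective g h)
    unfold pairSign
    rcases lt_or_gt_of_ne hne with h | h <;> rcases lt_or_gt_of_ne hne' with h' | h' <;>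
      simp [h, h', h.not_gt, h'.not_gt]
  rw [orientationSign_insert _ hxt, h1, neg_one_pow_card, Finset.prod_insert hxt,
    Finset.erase_insert hxt, mul_assoc, h2]
  simp [mul_comm]

/-- The orientation-preserving action on chains: `g · x₀x₁…x_q = sgn(π) y₀y₁…y_q`. -/
def action (G V : Type*) [LinearOrder V] [Group G] [MulAction G V] :
    Representation ℤ G (Finset V →₀ ℤ) where
  toFun g := Finsupp.linearCombination ℤ fun s : Finset V =>
    Finsupp.single (g • s) (orientationSign g s)
  map_one' := by
    ext s : 2
    simp [orientationSign_one]
  map_mul' g h := by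
    ext s : 2
    simp [orientationSign_mul, mul_smul, mul_comm]

lemma action_single (g : G) (s : Finset V) (a : ℤ) :
    action G V g (Finsupp.single s a) = Finsupp.single (g • s) (a * orientationSign g s) := by
  simp [action]

lemma boundary_action (g : G) (c : Finset V →₀ ℤ) :
    boundary V (action G V g c) = action G V g (boundary V c) := by
  suffices h : boundary V ∘ₗ action G V g = action G V g ∘ₗ boundary V from
    LinearMap.congr_fun h c
  ext s : 2
  simp only [LinearMap.comp_apply, Finsupp.lsingle_apply, action_single, boundary_single,
    map_sum, one_mul, one_smul, Finset.smul_sum, Finsupp.smul_single, smul_eq_mul]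
  rw [Finset.smul_finset_def,
    Finset.sum_image fun x _ y _ hxy => MulAction.injective g hxy, ← Finset.smul_finset_def]
  refine Finset.sum_congr rfl fun x hx => ?_
  rw [orientationSign_erase g hx]
  congr 1
  ext y
  simp only [Finset.mem_erase, Finset.mem_smul_finset]
  constructor
  · rintro ⟨hy, z, hz, rfl⟩
    exact ⟨z, ⟨fun h => hy (h ▸ rfl), hz⟩, rfl⟩
  · rintro ⟨z, ⟨hzx, hz⟩, rfl⟩
    exact ⟨fun h => hzx (MulAction.injective g h), z, hz, rfl⟩

/-! ### Reduced simplicial homology -/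

/-- The chains of `X` on the faces with `k` vertices, i.e. the group `C_{k-1}(X, ℤ)` of the reduced
chain complex. The empty face is included, so for `k = 0` this is `C_{-1}(X, ℤ) = ℤ`. -/
def chains (X : AbstractSimplicialComplex V) (k : ℕ) : Submodule ℤ (Finset V →₀ ℤ) :=
  Finsupp.supported ℤ ℤ {s | s.card = k ∧ (s = ∅ ∨ s ∈ X.faces)}

/-- The reduced `q`-cycles of `X`. -/
def cycles (X : AbstractSimplicialComplex V) (q : ℕ) : Submodule ℤ (Finset V →₀ ℤ) :=
  chains X (q + 1) ⊓ LinearMap.ker (boundary V)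

/-- The `q`-boundaries of `X`. -/
def boundaries (X : AbstractSimplicialComplex V) (q : ℕ) : Submodule ℤ (Finset V →₀ ℤ) :=
  (chains X (q + 2)).map (boundary V)

/-- The reduced simplicial homology `H̃_q(X, ℤ)`, for `q ≥ 0`. -/
abbrev Homology (X : AbstractSimplicialComplex V) (q : ℕ) : Type _ :=
  cycles X q ⧸ (boundaries X q).submoduleOf (cycles X q)

section Action

variable (X : AbstractSimplicialComplex V)

lemma action_mem_chains (hX : ∀ (g : G), ∀ s ∈ X.faces, g • s ∈ X.faces) (k : ℕ) (g : G) {c : Finset V →₀ ℤ} (hc : c ∈ chains X k) :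
    action G V g c ∈ chains X k := by
  suffices h : chains X k ≤ (chains X k).comap (action G V g) from h hc
  rw [chains, Finsupp.supported_eq_span_single, Submodule.span_le]
  rintro _ ⟨s, ⟨hs, hs'⟩, rfl⟩
  rw [← Finsupp.supported_eq_span_single, SetLike.mem_coe, Submodule.mem_comap, action_single]
  refine Finsupp.single_mem_supported ℤ _ ⟨by simpa using hs, ?_⟩
  rcases hs' with rfl | hs'
  · simp
  · exact Or.inr (hX g s hs')

/-- The action on the chain group `C_{k-1}(X, ℤ)`. -/
def chainRep (hX : ∀ (g : G), ∀ s ∈ X.faces, g • s ∈ X.faces) (k : ℕ) : Representation ℤ G (chains X k) :=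
  (action G V).subrepresentation (chains X k) fun g _ hc => action_mem_chains X hX k g hc

/-- The action on the group of reduced `q`-cycles. -/
def cycleRep (hX : ∀ (g : G), ∀ s ∈ X.faces, g • s ∈ X.faces) (q : ℕ) : Representation ℤ G (cycles X q) :=
  (action G V).subrepresentation (cycles X q) fun g c hc =>
    ⟨action_mem_chains X hX (q + 1) g hc.1, by
      have h : boundary V c = 0 := hc.2
      change boundary V (action G V g c) = 0
      rw [boundary_action, h, map_zero]⟩

/-- The induced action on `H̃_q(X, ℤ)`. -/
def homologyRep (hX : ∀ (g : G), ∀ s ∈ X.faces, g • s ∈ X.faces) (q : ℕ) : Representation ℤ G (Homology X q) :=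
  (cycleRep X hX q).quotient ((boundaries X q).submoduleOf (cycles X q)) fun g c hc => by
    obtain ⟨b, hb, hbc⟩ : ∃ b ∈ chains X (q + 2), boundary V b = c := hc
    refine ⟨action G V g b, action_mem_chains X hX (q + 2) g hb, ?_⟩
    rw [boundary_action, hbc]
    rfl

end Action

/-! ### Facets and homology facets -/

/-- Facets are the maximal faces. -/
def IsFacet (X : AbstractSimplicialComplex V) (s : Finset V) : Prop :=
  Maximal (fun t => t ∈ X.faces) s

/-- For an ordering `r` of the facets: the set of those vertices `x` of the facet `s` such that
`s \ x` is a face of some facet that comes before `s`. -/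
def restrictionSet (X : AbstractSimplicialComplex V) (r : Finset V → Finset V → Prop)
    (s : Finset V) : Set V :=
  {x | x ∈ s ∧ ∃ t, IsFacet X t ∧ r t s ∧ s.erase x ⊆ t}

/-- A homology facet is a facet that equals its restriction set. -/
def IsHomologyFacet (X : AbstractSimplicialComplex V) (r : Finset V → Finset V → Prop)
    (s : Finset V) : Prop :=
  IsFacet X s ∧ restrictionSet X r s = (s : Set V)

/-- The homology class `h` is the basis element of `H̃_q(X, ℤ)` that corresponds to the homology
facet `s`: it is represented by a cycle with coefficient `1` at the oriented simplex `s` and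
coefficient `0` at the other `q`-dimensional homology facets. -/
def IsFacetClass (X : AbstractSimplicialComplex V) (r : Finset V → Finset V → Prop) (q : ℕ)
    (s : Finset V) (h : Homology X q) : Prop :=
  ∃ z : cycles X q, Submodule.Quotient.mk z = h ∧ (z : Finset V →₀ ℤ) s = 1 ∧
    ∀ t, IsHomologyFacet X r t → t.card = q + 1 → t ≠ s → (z : Finset V →₀ ℤ) t = 0

end OrientedChain

/-! ### The matching complex of the complete hypergraph -/

namespace MatchingComplex

open OrientedChain

/-- The proper non-empty subsets of `[n]`. -/
def Block (n : ℕ) : Type := {x : Finset (Fin n) // x.Nonempty ∧ x ≠ Finset.univ}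

namespace Block

variable {n : ℕ}

/-- The elements of a block. -/
def toFinset (x : Block n) : Finset (Fin n) := x.1

/-- Blocks are ordered by decreasing size, and those of a given size lexicographically. -/
instance : LinearOrder (Block n) :=
  LinearOrder.lift'
    (fun x : Block n => (toLex (OrderDual.toDual x.toFinset.card, x.toFinset.sort (· ≤ ·)) :
      ℕᵒᵈ ×ₗ List (Fin n)))
    fun x y h => by
      have h2 : x.toFinset.sort (· ≤ ·) = y.toFinset.sort (· ≤ ·) :=
        congrArg (fun p => (ofLex p).2) h
      have h3 : x.toFinset = y.toFinset := by simpa using congrArg List.toFinset h2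
      exact Subtype.ext h3

/-- The symmetric group acts on blocks by `g • x = {g m | m ∈ x}`. -/
instance : MulAction (Equiv.Perm (Fin n)) (Block n) where
  smul g x := ⟨g • x.1, x.2.1.smul_finset, fun h => x.2.2 (by
    rw [← inv_smul_smul g x.1, h, Finset.smul_finset_univ])⟩
  one_smul x := Subtype.ext (one_smul _ x.1)
  mul_smul g h x := Subtype.ext (mul_smul g h x.1)

lemma toFinset_smul (g : Equiv.Perm (Fin n)) (x : Block n) :
    (g • x).toFinset = g • x.toFinset := rfl

end Block

/-- The complex `X(n)`: its vertices are the proper non-empty subsets of `[n]`, its faces the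
non-empty collections of pairwise disjoint vertices, i.e. the partitions of subsets of `[n]` into
proper non-empty blocks. -/
def complex (n : ℕ) : AbstractSimplicialComplex (Block n) where
  faces := {s | s.Nonempty ∧ ∀ x ∈ s, ∀ y ∈ s, x ≠ y → Disjoint x.toFinset y.toFinset}
  isRelLowerSet_faces := fun _ hs =>
    ⟨hs.1, fun _ hts ht => ⟨ht, fun x hx y hy => hs.2 x (hts hx) y (hts hy)⟩⟩
  singleton_mem v := ⟨Finset.singleton_nonempty v, fun x hx y hy hxy => by
    rw [Finset.mem_singleton] at hx hy
    exact absurd (hx.trans hy.symm) hxy⟩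

lemma smul_mem_complex (n : ℕ) (g : Equiv.Perm (Fin n)) (s : Finset (Block n))
    (hs : s ∈ (complex n).faces) : g • s ∈ (complex n).faces := by
  refine ⟨hs.1.smul_finset, fun x hx y hy hxy => ?_⟩
  obtain ⟨x, hx', rfl⟩ := Finset.mem_smul_finset.1 hx
  obtain ⟨y, hy', rfl⟩ := Finset.mem_smul_finset.1 hy
  rw [Block.toFinset_smul, Block.toFinset_smul, Finset.smul_finset_def, Finset.smul_finset_def,
    Finset.disjoint_image (MulAction.injective g)]
  exact hs.2 x hx' y hy' fun h => hxy (h ▸ rfl)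

/-- The `ℤSₙ`-module of chains of `X(n)` on the faces with `k` vertices. -/
def chainRep (n k : ℕ) : Representation ℤ (Equiv.Perm (Fin n)) (chains (complex n) k) :=
  OrientedChain.chainRep (complex n) (smul_mem_complex n) k

/-- The `ℤSₙ`-module `H̃_q(X(n), ℤ)`. -/
def homologyRep (n q : ℕ) : Representation ℤ (Equiv.Perm (Fin n)) (Homology (complex n) q) :=
  OrientedChain.homologyRep (complex n) (smul_mem_complex n) q

/-- The number of singleton blocks. -/
def singletons {n : ℕ} (s : Finset (Block n)) : ℕ :=
  (s.filter fun x => x.toFinset.card = 1).card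

/-- `r` is a strict total order on the facets of `X(n)` in which the facets with more singleton
blocks come first. -/
structure IsFacetOrder (n : ℕ) (r : Finset (Block n) → Finset (Block n) → Prop) : Prop where
  irrefl : ∀ s, IsFacet (complex n) s → ¬ r s s
  trans : ∀ s t u, IsFacet (complex n) s → IsFacet (complex n) t → IsFacet (complex n) u →
    r s t → r t u → r s u
  total : ∀ s t, IsFacet (complex n) s → IsFacet (complex n) t → s ≠ t → r s t ∨ r t s
  singletons_lt : ∀ s t, IsFacet (complex n) s → IsFacet (complex n) t →
    singletons t < singletons s → r s t

/-- The facet `s = x₀x₁…x_q` has shape `p` when `p` is the partition with parts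
`|x₀|, |x₁|, …, |x_q|`. -/
def HasShape {n : ℕ} (s : Finset (Block n)) (p : n.Partition) : Prop :=
  s.val.map (fun x => x.toFinset.card) = p.parts

/-- The subgroup of the chain group spanned by the (oriented) facets of shape `p`. -/
def facetSpan {n : ℕ} (p : n.Partition) : Submodule ℤ (chains (complex n) p.parts.card) :=
  Submodule.span ℤ {c | ∃ s, IsFacet (complex n) s ∧ HasShape s p ∧
    (c : Finset (Block n) →₀ ℤ) = Finsupp.single s 1}

/-- The subgroup `V(p)` of `H̃_q(X(n), ℤ)` spanned by the homology facets of shape `p`. -/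
def homologyFacetSpan {n : ℕ} (r : Finset (Block n) → Finset (Block n) → Prop) (q : ℕ)
    (p : n.Partition) : Submodule ℤ (Homology (complex n) q) :=
  Submodule.span ℤ {h | ∃ s, IsHomologyFacet (complex n) r s ∧ HasShape s p ∧
    IsFacetClass (complex n) r q s h}

/-! ### Young subgroups and their normalisers -/

variable {n : ℕ}

/-- The parts `λ₀ ≥ λ₁ ≥ … ≥ λ_q` of a partition of `n`, as a composition of `n`. Its `i`-th block
is the interval `{λ₀ + … + λ_{i-1} + 1, …, λ₀ + … + λ_i}` of `[n]`. -/
def composition (p : n.Partition) : Composition n where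
  blocks := p.parts.sort (· ≥ ·)
  blocks_pos := fun h => p.parts_pos ((Multiset.mem_sort _).1 h)
  blocks_sum := by
    rw [← Multiset.sum_coe, Multiset.sort_eq, p.parts_sum]

/-- The standard Young subgroup: the permutations that map each of the intervals to itself. -/
def youngSubgroup (p : n.Partition) : Subgroup (Equiv.Perm (Fin n)) where
  carrier := {g | ∀ m, (composition p).index (g m) = (composition p).index m}
  one_mem' := fun _ => rfl
  mul_mem' := fun {g h} hg hh m => (hg (h m)).trans (hh m)
  inv_mem' := fun {g} hg m => by
    simpa using (hg (g⁻¹ m)).symm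

/-- The normaliser of the standard Young subgroup in the symmetric group. -/
def youngNormalizer (p : n.Partition) : Subgroup (Equiv.Perm (Fin n)) :=
  Subgroup.normalizer (youngSubgroup p : Set (Equiv.Perm (Fin n)))

lemma index_apply_eq (p : n.Partition) {g : Equiv.Perm (Fin n)} (hg : g ∈ youngNormalizer p)
    {a b : Fin n} (h : (composition p).index a = (composition p).index b) :
    (composition p).index (g a) = (composition p).index (g b) := by
  have h1 : Equiv.swap a b ∈ youngSubgroup p := by
    intro m
    by_cases hma : m = a
    · rw [hma, Equiv.swap_apply_left, h]
    · by_cases hmb : m = b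
      · rw [hmb, Equiv.swap_apply_right, h]
      · rw [Equiv.swap_apply_of_ne_of_ne hma hmb]
  have h2 : g * Equiv.swap a b * g⁻¹ ∈ youngSubgroup p := (hg _).1 h1
  simpa using (h2 (g a)).symm

/-- The permutation `ḡ` of the indices `0, …, q` of the blocks `x₀, …, x_q` induced by an element
`g` of the normaliser, so that `g • xᵢ = x_{ḡ i}`; see `blockPerm_index`. -/
def blockPerm (p : n.Partition) :
    youngNormalizer p →* Equiv.Perm (Fin (composition p).length) :=
  MonoidHom.toHomPerm
    { toFun := fun g i => (composition p).index
        (g.1 ((composition p).embedding i ⟨0, (composition p).one_le_blocksFun i⟩))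
      map_one' := by
        funext i
        simp
        rfl
      map_mul' := fun g h => by
        funext i
        refine index_apply_eq p g.2 ?_
        simp }

lemma blockPerm_index (p : n.Partition) (g : youngNormalizer p) (m : Fin n) :
    blockPerm p g ((composition p).index m) = (composition p).index (g.1 m) :=
  index_apply_eq p g.2 (by simp)

/-- Two elements of the normaliser induce the same permutation of the blocks exactly if they agree
modulo the Young subgroup. -/
lemma mem_ker_blockPerm (p : n.Partition) (g : youngNormalizer p) :
    blockPerm p g = 1 ↔ g.1 ∈ youngSubgroup p := by
  constructor
  · intro h m
    rw [← blockPerm_index, h, Equiv.Perm.one_apply]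
  · intro h
    ext1 i
    have := blockPerm_index p g
      ((composition p).embedding i ⟨0, (composition p).one_le_blocksFun i⟩)
    rw [h, Composition.index_embedding] at this
    exact this

/-- The rank one module `V = ℤ[v]` with `g · v = sgn(ḡ) v`. -/
def signRep (p : n.Partition) : Representation ℤ (youngNormalizer p) ℤ where
  toFun g := (Equiv.Perm.sign (blockPerm p g) : ℤ) • LinearMap.id
  map_one' := by
    ext
    simp
  map_mul' g h := by
    ext
    simp

/-- The underlying abelian group of the module `V` induced from the normaliser up to the symmetric
group. -/
abbrev Induced (p : n.Partition) : Type :=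
  Representation.IndV (youngNormalizer p).subtype (signRep p)

instance (p : n.Partition) : AddCommGroup (Induced p) :=
  Submodule.Quotient.addCommGroup _

instance (p : n.Partition) : AddCommMonoid (Induced p) :=
  AddCommGroup.toAddCommMonoid

/-- The module `V` induced from the normaliser up to the symmetric group. -/
def inducedRep (p : n.Partition) : Representation ℤ (Equiv.Perm (Fin n)) (Induced p) :=
  Representation.ind (youngNormalizer p).subtype (signRep p)

/-- The partitions of `n` of length `q + 1` with no parts of size `1` or `n`. -/
abbrev Shape (n q : ℕ) : Type :=
  {p : n.Partition // p.parts.card = q + 1 ∧ 1 ∉ p.parts ∧ n ∉ p.parts}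

end MatchingComplex

end

/-! The homology facets are exactly the facets without singleton blocks (`isHomologyFacet_iff`),
whatever admissible order is chosen, and all other simplices form an acyclic complex. Call an
element of `[n]` free for a face if no block of size at least two contains it; a face is not a
homology facet precisely when it has a free element (`freeElements_nonempty_iff`). The faces with
the same non-singleton blocks share their free elements, and if `m` is the least of these, adding
the block `{m}` is a cone construction on them. Filtering by the number of non-singleton blocks
assembles these cones into acyclicity (`exists_boundary_eq`,
`exists_boundary_eq_of_freeElements_nonempty`). The empty simplex takes part, so this is acyclicity
of the augmented complex.

Reading off the coefficients at the `q`-dimensional homology facets is therefore an isomorphism from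
the homology onto a free abelian group (`homologyCoeff`). It is well defined because boundaries
vanish at maximal faces, injective because a cycle vanishing at all homology facets lives in the
acyclic part, and surjective because the boundary of a homology facet can be filled inside the
acyclic part. The dual basis `homologyBasis` consists of the classes in the theorem.

The symmetric group permutes this basis, and likewise the oriented facets in the chain group, up to
orientation signs. The facets of a fixed shape form one orbit (`exists_smul_stdFacet_eq`). The
stabiliser of the facet made of the standard intervals is the normaliser of the Young subgroup
(`mem_youngNormalizer_iff`), and it acts there by the sign of the permutation of the intervals
(`orientationSign_stdFacet`). A basis permuted transitively up to signs gives an induced module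
(`Representation.nonempty_equiv_ind_of_basis`). Sorting the homology basis by shape gives the direct
sum. -/

noncomputable section

/-! ### Cone operators and acyclicity of filtered families of simplices -/

namespace OrientedChain

variable {V : Type*} [LinearOrder V]

/-- The sign `(-1)^i`, where `i` is the number of vertices of `s` smaller than `x`. -/
def positionSign (x : V) (s : Finset V) : ℤ := (-1) ^ (s.filter fun y => y < x).card

lemma positionSign_insert (x : V) {y : V} {s : Finset V} (hy : y ∉ s) :
    positionSign x (insert y s) = (if y < x then -1 else 1) * positionSign x s := by
  rw [positionSign, positionSign, neg_one_pow_card, neg_one_pow_card, Finset.prod_insert hy]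

lemma positionSign_mul_self (x : V) (s : Finset V) : positionSign x s * positionSign x s = 1 := by
  rw [positionSign, ← mul_pow]
  simp

lemma boundary_single_one (s : Finset V) :
    boundary V (Finsupp.single s 1) =
      ∑ x ∈ s, Finsupp.single (s.erase x) (positionSign x s) := by
  rw [boundary_single, one_smul]
  rfl

/-- The operator `x₀…x_q ↦ v x₀…x_q` on the chains of the full simplex. -/
def cone (v : V) : (Finset V →₀ ℤ) →ₗ[ℤ] (Finset V →₀ ℤ) :=
  Finsupp.linearCombination ℤ fun s : Finset V =>
    if v ∈ s then 0 else Finsupp.single (insert v s) (positionSign v s)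

lemma cone_single_of_mem {v : V} {s : Finset V} (h : v ∈ s) (a : ℤ) :
    cone v (Finsupp.single s a) = 0 := by
  simp [cone, h]

lemma cone_single_of_notMem {v : V} {s : Finset V} (h : v ∉ s) (a : ℤ) :
    cone v (Finsupp.single s a) = Finsupp.single (insert v s) (a * positionSign v s) := by
  simp [cone, h]

/-- The contracting homotopy of the full simplex with apex `v`. For a simplex containing `v` only
the face opposite `v` survives; otherwise the faces of the cone through `v` cancel against the cone
over the boundary. -/
lemma boundary_cone (v : V) (c : Finset V →₀ ℤ) :
    boundary V (cone v c) + cone v (boundary V c) = c := by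
  suffices h : boundary V ∘ₗ cone v + cone v ∘ₗ boundary V = LinearMap.id from
    LinearMap.congr_fun h c
  ext s : 2
  simp only [LinearMap.add_apply, LinearMap.comp_apply, Finsupp.lsingle_apply, LinearMap.id_apply,
    boundary_single_one, map_sum]
  by_cases hv : v ∈ s
  · rw [cone_single_of_mem hv, map_zero, zero_add, Finset.sum_eq_single_of_mem v hv,
      cone_single_of_notMem (Finset.notMem_erase v s), Finset.insert_erase hv]
    · have := positionSign_insert v (Finset.notMem_erase v s)
      rw [Finset.insert_erase hv, if_neg (lt_irrefl v), one_mul] at this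
      rw [this, positionSign_mul_self]
    · intro x _ hxv
      exact cone_single_of_mem (Finset.mem_erase.2 ⟨hxv.symm, hv⟩) _
  · rw [cone_single_of_notMem hv, ← mul_one (1 * positionSign v s), ← smul_eq_mul,
      ← Finsupp.smul_single, map_smul, boundary_single_one, Finset.sum_insert hv,
      Finset.erase_insert hv, smul_add, add_assoc, Finset.smul_sum, ← Finset.sum_add_distrib,
      Finset.sum_eq_zero, add_zero, Finsupp.smul_single, positionSign_insert _ hv,
      if_neg (lt_irrefl v), one_mul, smul_eq_mul, positionSign_mul_self]
    intro x hx
    obtain ⟨t, hxt, rfl⟩ : ∃ t, x ∉ t ∧ insert x t = s :=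
      ⟨s.erase x, Finset.notMem_erase x s, Finset.insert_erase hx⟩
    have hvx : v ≠ x := fun h => hv (h ▸ hx)
    have hvt : v ∉ t := fun h => hv (Finset.mem_insert_of_mem h)
    rw [Finset.erase_insert_of_ne hvx, Finset.erase_insert hxt, cone_single_of_notMem hvt,
      Finsupp.smul_single, ← Finsupp.single_add, positionSign_insert _ hv,
      positionSign_insert _ hxt, positionSign_insert _ hxt, if_neg (lt_irrefl x)]
    -- Exactly one of `v < x` and `x < v` holds, so the two products of signs are opposite.
    rcases lt_or_gt_of_ne hvx with h | h <;> simp [h, h.not_gt, mul_comm]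

/-- Induction on the simplex: up to sign, a simplex with one more vertex is a cone, and applying the
homotopy formula twice reduces the claim to its base. -/
lemma boundary_boundary (c : Finset V →₀ ℤ) : boundary V (boundary V c) = 0 := by
  suffices h : boundary V ∘ₗ boundary V = 0 from LinearMap.congr_fun h c
  ext s : 2
  simp only [LinearMap.comp_apply, Finsupp.lsingle_apply, LinearMap.zero_apply]
  induction s using Finset.induction_on with
  | empty => simp [boundary_single_one]
  | insert v s hv ih =>
    have h1 : Finsupp.single (insert v s) (1 : ℤ) =
        positionSign v s • cone v (Finsupp.single s 1) := by
      rw [cone_single_of_notMem hv, Finsupp.smul_single, one_mul, smul_eq_mul,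
        positionSign_mul_self]
    have h2 : boundary V (cone v (Finsupp.single s 1)) =
        Finsupp.single s 1 - cone v (boundary V (Finsupp.single s 1)) :=
      eq_sub_of_add_eq (boundary_cone v _)
    have h3 := boundary_cone v (boundary V (Finsupp.single s 1))
    rw [ih, map_zero, add_zero] at h3
    rw [h1, map_smul, map_smul, h2, map_sub, h3, sub_self, smul_zero]

/-- Acyclicity of a family `K` of simplices that is filtered by a weight `w`, such that on the
simplices of a given weight adding the vertex `m s` is a cone construction. -/
theorem exists_boundary_eq (K : Set (Finset V)) (w : Finset V → ℕ) (m : Finset V → V)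
    (hins : ∀ s ∈ K, insert (m s) s ∈ K ∧ w (insert (m s) s) = w s)
    (hK : ∀ s ∈ K, ∀ x ∈ s, s.erase x ∈ K ∧
      (w (s.erase x) = w s ∧ m (s.erase x) = m s ∨
        w (s.erase x) < w s ∧ insert (m s) (s.erase x) ∈ K ∧
          w (insert (m s) (s.erase x)) < w s))
    {k : ℕ} {c : Finset V →₀ ℤ} (hc : c ∈ Finsupp.supported ℤ ℤ {s | s ∈ K ∧ s.card = k})
    (hcycle : boundary V c = 0) :
    ∃ b ∈ Finsupp.supported ℤ ℤ {s | s ∈ K ∧ s.card = k + 1}, boundary V b = c := by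
  -- The candidate homotopy cones each simplex with its own apex `m s`. It fails to contract only
  -- where the apex changes on passing to a face, and there the weight drops.
  let h : (Finset V →₀ ℤ) →ₗ[ℤ] (Finset V →₀ ℤ) :=
    Finsupp.linearCombination ℤ fun s => cone (m s) (Finsupp.single s 1)
  have h_single : ∀ s (a : ℤ), h (Finsupp.single s a) = cone (m s) (Finsupp.single s a) := by
    intro s a
    rw [Finsupp.linearCombination_single, ← map_smul, Finsupp.smul_single, smul_eq_mul, mul_one]
  let F : ℕ → Submodule ℤ (Finset V →₀ ℤ) := fun N =>
    Finsupp.supported ℤ ℤ {s | s ∈ K ∧ s.card = k ∧ w s < N}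
  have h_mem : ∀ N, ∀ c ∈ F N, h c ∈ Finsupp.supported ℤ ℤ {s | s ∈ K ∧ s.card = k + 1} := by
    intro N
    change F N ≤ (Finsupp.supported ℤ ℤ _).comap h
    rw [show F N = _ from Finsupp.supported_eq_span_single _ _, Submodule.span_le]
    rintro _ ⟨s, ⟨hs, hsk, -⟩, rfl⟩
    rw [SetLike.mem_coe, Submodule.mem_comap, h_single]
    by_cases hm : m s ∈ s
    · rw [cone_single_of_mem hm]
      exact zero_mem _
    · rw [cone_single_of_notMem hm]
      exact Finsupp.single_mem_supported ℤ _
        ⟨(hins s hs).1, by rw [Finset.card_insert_of_notMem hm, hsk]⟩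
  -- The error of the homotopy strictly lowers the weight. On a simplex `s` it is the signed sum,
  -- over the faces of `s`, of the cone with apex `m s` minus the cone with the face's own apex.
  have T_mem : ∀ N, ∀ c ∈ F (N + 1), c - boundary V (h c) - h (boundary V c) ∈ F N := by
    intro N
    change F (N + 1) ≤ (F N).comap (LinearMap.id - boundary V ∘ₗ h - h ∘ₗ boundary V)
    rw [show F (N + 1) = _ from Finsupp.supported_eq_span_single _ _, Submodule.span_le]
    rintro _ ⟨s, ⟨hs, hsk, hsN⟩, rfl⟩
    simp only [SetLike.mem_coe, Submodule.mem_comap, LinearMap.sub_apply, LinearMap.id_apply,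
      LinearMap.comp_apply]
    rw [h_single, sub_eq_of_eq_add' (boundary_cone (m s) _).symm, boundary_single_one, map_sum,
      map_sum, ← Finset.sum_sub_distrib]
    refine Submodule.sum_mem _ fun x hx => ?_
    obtain ⟨hsK, ⟨-, hm⟩ | ⟨hw, hiK, hiw⟩⟩ := hK s hs x hx
    · rw [h_single, hm, sub_self]
      exact zero_mem _
    · have key : ∀ v, insert v (s.erase x) ∈ K → w (insert v (s.erase x)) < w s → ∀ a : ℤ,
          cone v (Finsupp.single (s.erase x) a) ∈ F N := by
        intro v hv hvw a
        by_cases hvx : v ∈ s.erase x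
        · rw [cone_single_of_mem hvx]
          exact zero_mem _
        · rw [cone_single_of_notMem hvx]
          refine Finsupp.single_mem_supported ℤ _ ⟨hv, ?_, by omega⟩
          rw [Finset.card_insert_of_notMem hvx, Finset.card_erase_add_one hx, hsk]
      rw [h_single]
      exact sub_mem (key _ hiK hiw _) (key _ (hins _ hsK).1 ((hins _ hsK).2.trans_lt hw) _)
  have main : ∀ N, ∀ c ∈ F N, boundary V c = 0 →
      ∃ b ∈ Finsupp.supported ℤ ℤ {s | s ∈ K ∧ s.card = k + 1}, boundary V b = c := by
    intro N
    induction N with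
    | zero =>
      intro c hc _
      refine ⟨0, zero_mem _, ?_⟩
      have : {s : Finset V | s ∈ K ∧ s.card = k ∧ w s < 0} = ∅ := by simp
      rw [show F 0 = ⊥ by simp only [F, this, Finsupp.supported_empty]] at hc
      rw [(Submodule.mem_bot ℤ).1 hc, map_zero]
    | succ N ih =>
      intro c hc hcycle
      have hT := T_mem N c hc
      rw [hcycle, map_zero, sub_zero] at hT
      -- For a cycle the error is `c - ∂ (h c)`, again a cycle, so induction on the weight fills it.
      obtain ⟨b, hb, hbc⟩ := ih _ hT (by rw [map_sub, hcycle, boundary_boundary, sub_zero])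
      exact ⟨b + h c, add_mem hb (h_mem _ c hc), by rw [map_add, hbc, sub_add_cancel]⟩
  refine main (c.support.sup w + 1) c ?_ hcycle
  intro s hs
  exact ⟨(hc hs).1, (hc hs).2, Nat.lt_succ_of_le (Finset.le_sup hs)⟩

end OrientedChain

/-! ### Induced modules from signed permutation bases, and direct sums -/

namespace Representation

variable {k G M Ω : Type*} [CommRing k] [Group G] [AddCommGroup M] [Module k M] [MulAction G Ω]

/-- A representation with a basis that is permuted transitively, up to signs, is induced from the
stabiliser of a basis element. -/
theorem nonempty_equiv_ind_of_basis (ρ : Representation k G M) (b : Module.Basis Ω k M)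
    (ε : G → Ω → k) (hε : ∀ g s, ε g s * ε g s = 1)
    (hρ : ∀ g s, ρ g (b s) = ε g s • b (g • s)) (N : Subgroup G) (χ : Representation k N k)
    (s₀ : Ω) (htrans : ∀ s, ∃ g : G, g • s₀ = s) (hN : ∀ g, g ∈ N ↔ g • s₀ = s₀)
    (hχ : ∀ h : N, χ h 1 = ε h s₀) :
    Nonempty (ρ.Equiv (ind N.subtype χ)) := by
  choose γ hγ using htrans
  have hfix : ∀ h : N, ρ h (b s₀) = χ h 1 • b s₀ := fun h => by rw [hρ, (hN _).1 h.2, hχ]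
  have hfix' : ∀ h : N, χ h 1 • ρ (h : G)⁻¹ (b s₀) = b s₀ := fun h => by
    rw [← map_smul, ← hfix, inv_self_apply]
  -- The inverse in `g ⊗ a ↦ a • ρ g⁻¹ (b s₀)` reflects the model of induction: `N` acts on the
  -- group factor by left multiplication, and `G` acts by right multiplication by inverses.
  let φ : IndV N.subtype χ →ₗ[k] M := Coinvariants.lift _
    (TensorProduct.lift ((Finsupp.linearCombination k fun g : G =>
      (LinearMap.toSpanSingleton k M (ρ g⁻¹ (b s₀)))) ∘ₗ
        (MonoidAlgebra.coeffLinearEquiv k).toLinearMap)) (by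
      intro h
      ext g
      have := congrArg (ρ g⁻¹) (hfix' h)
      rw [map_smul] at this
      simp [this])
  have hφ : ∀ g a, φ (IndV.mk N.subtype χ g a) = a • ρ g⁻¹ (b s₀) := by
    intro g a
    change TensorProduct.lift _ (MonoidAlgebra.single g 1 ⊗ₜ[k] a) = _
    simp
  -- The inverse uses a chosen `γ s` carrying `s₀` to `s`. The factor `ε (γ s) s₀` is its own
  -- inverse, so it undoes the sign that `ρ (γ s)` introduces.
  let ψ : M →ₗ[k] IndV N.subtype χ :=
    b.constr k fun s => IndV.mk N.subtype χ (γ s)⁻¹ (ε (γ s) s₀)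
  have hψ : ∀ s, ψ (b s) = IndV.mk N.subtype χ (γ s)⁻¹ (ε (γ s) s₀) := fun s => by simp [ψ]
  have h1 : φ ∘ₗ ψ = LinearMap.id := by
    refine b.ext fun s => ?_
    rw [LinearMap.comp_apply, hψ, hφ, inv_inv, hρ, hγ, smul_smul, hε, one_smul]
    rfl
  have h2 : ψ ∘ₗ φ = LinearMap.id := by
    refine IndV.hom_ext _ _ fun g => LinearMap.ext_ring ?_
    change ψ (φ (IndV.mk N.subtype χ g 1)) = IndV.mk N.subtype χ g 1
    let s := g⁻¹ • s₀
    have hs : γ s • s₀ = g⁻¹ • s₀ := hγ s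
    -- Both `g⁻¹` and `γ s` carry `s₀` to `s`, so they differ by an element of the stabiliser; the
    -- coinvariant relation moves it into the coefficient as a value of `χ`.
    let h : N := ⟨g * γ s, (hN _).2 (by rw [mul_smul, hs, smul_inv_smul])⟩
    have e1 : IndV.mk N.subtype χ g (1 : k) = IndV.mk N.subtype χ (γ s)⁻¹ (χ h⁻¹ 1) := by
      have := Coinvariants.mk_inv_tmul ((leftRegular k G).comp N.subtype) χ
        (MonoidAlgebra.single (γ s)⁻¹ 1) 1 h⁻¹
      refine Eq.trans ?_ this
      have hx : ((leftRegular k G).comp N.subtype) h⁻¹⁻¹ (MonoidAlgebra.single (γ s)⁻¹ 1) =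
          MonoidAlgebra.single g (1 : k) := by
        simp [h]
      rw [hx]
      rfl
    have e2 : ρ g⁻¹ (b s₀) = (ε (γ s) s₀ * χ h⁻¹ 1) • b s := by
      have hg' : g⁻¹ = γ s * (h⁻¹ : N) := by simp [h]
      rw [hg', map_mul, Module.End.mul_apply, hfix, map_smul, hρ, hγ, smul_smul, mul_comm]
    rw [hφ, one_smul, e2, map_smul, hψ, e1, ← map_smul]
    congr 1
    rw [smul_eq_mul, mul_right_comm, hε, one_mul]
  have h3 : ∀ g x, ρ g (φ x) = φ (ind N.subtype χ g x) := by
    intro g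
    refine LinearMap.congr_fun (f := ρ g ∘ₗ φ) (g := φ ∘ₗ ind N.subtype χ g) ?_
    refine IndV.hom_ext _ _ fun h => LinearMap.ext_ring ?_
    change ρ g (φ (IndV.mk N.subtype χ h 1)) = φ (ind N.subtype χ g (IndV.mk N.subtype χ h 1))
    rw [ind_mk, hφ, hφ]
    simp
  refine ⟨(Representation.Equiv.mk (LinearEquiv.ofLinearMap φ ψ h1 h2) fun g => ?_).symm⟩
  exact LinearMap.ext fun x => (h3 g x).symm

/-- A linearly independent family that is permuted transitively, up to signs, spans a
subrepresentation that is induced from the stabiliser of a member of the family. -/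
theorem exists_subrepresentation_equiv_ind (ρ : Representation k G M) {v : Ω → M}
    (hv : LinearIndependent k v) (ε : G → Ω → k) (hε : ∀ g s, ε g s * ε g s = 1)
    (hρ : ∀ g s, ρ g (v s) = ε g s • v (g • s)) (N : Subgroup G) (χ : Representation k N k)
    (s₀ : Ω) (htrans : ∀ s, ∃ g : G, g • s₀ = s) (hN : ∀ g, g ∈ N ↔ g • s₀ = s₀)
    (hχ : ∀ h : N, χ h 1 = ε h s₀) :
    ∃ W : Subrepresentation ρ, W.toSubmodule = Submodule.span k (Set.range v) ∧
      Nonempty (W.toRepresentation.Equiv (ind N.subtype χ)) := by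
  have hW : ∀ g, Submodule.span k (Set.range v) ≤ (Submodule.span k (Set.range v)).comap (ρ g) := by
    intro g
    rw [Submodule.span_le]
    rintro _ ⟨s, rfl⟩
    rw [SetLike.mem_coe, Submodule.mem_comap, hρ]
    exact Submodule.smul_mem _ _ (Submodule.subset_span ⟨_, rfl⟩)
  refine ⟨⟨Submodule.span k (Set.range v), fun g _ hx => hW g hx⟩, rfl, ?_⟩
  refine nonempty_equiv_ind_of_basis _ (Module.Basis.span hv) ε hε (fun g s => ?_) N χ s₀ htrans
    hN hχ
  refine Subtype.ext ?_
  change ρ g (Module.Basis.span hv s : M) = ε g s • (Module.Basis.span hv (g • s) : M)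
  rw [Module.Basis.span_apply, Module.Basis.span_apply, hρ]

/-- A representation that is an internal direct sum is equivalent to the external direct sum of
representations equivalent to its summands. -/
theorem nonempty_equiv_directSum {ι : Type*} [DecidableEq ι] (ρ : Representation k G M)
    (W : ι → Subrepresentation ρ) (hW : DirectSum.IsInternal fun i => (W i).toSubmodule)
    {A : ι → Type*} [∀ i, AddCommGroup (A i)] [∀ i, Module k (A i)]
    (σ : ∀ i, Representation k G (A i)) (e : ∀ i, (W i).toRepresentation.Equiv (σ i)) :
    Nonempty (ρ.Equiv (directSum σ)) := by
  let S := DirectSum.coeLinearMap fun i => (W i).toSubmodule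
  let E : M ≃ₗ[k] DirectSum ι A := (LinearEquiv.ofBijective S hW).symm ≪≫ₗ
    DFinsupp.mapRange.linearEquiv fun i => (e i).toLinearEquiv
  have hS : ∀ i (x : (W i).toSubmodule), S (DirectSum.of (fun i => (W i).toSubmodule) i x) = x :=
    fun i x => DirectSum.coeLinearMap_of (fun i => (W i).toSubmodule) i x
  have hE : ∀ i (x : (W i).toSubmodule), E x = DirectSum.of A i (e i x) := by
    intro i x
    have : (LinearEquiv.ofBijective S hW).symm (x : M) =
        DirectSum.of (fun i => (W i).toSubmodule) i x := by
      rw [LinearEquiv.symm_apply_eq]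
      exact (hS i x).symm
    rw [LinearEquiv.trans_apply, this]
    exact DFinsupp.mapRange_single (hf := fun i => map_zero (e i).toLinearEquiv)
  -- As `S` is surjective, equivariance may be tested on its values, hence summand by summand.
  have h : ∀ g x, E (ρ g (S x)) = directSum σ g (E (S x)) := by
    intro g x
    induction x using DirectSum.induction_on with
    | zero => simp only [map_zero]
    | of i x =>
      have h1 := hE i ((W i).toRepresentation g x)
      have h2 : e i ((W i).toRepresentation g x) = σ i g (e i x) :=
        IntertwiningMap.isIntertwining _ _ (e i).toIntertwiningMap g x
      rw [hS, hE]
      refine h1.trans ?_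
      rw [h2]
      exact (DirectSum.lmap_lof (R := k) (fun i => σ i g) i (e i x)).symm
    | add x y hx hy => simp only [map_add, hx, hy]
  refine ⟨Representation.Equiv.mk E fun g => LinearMap.ext fun m => ?_⟩
  obtain ⟨x, rfl⟩ := hW.2 m
  exact h g x

end Representation

/-- The spans of the fibres of a partition of a basis form an internal direct sum. -/
theorem Module.Basis.isInternal_span_fibers {R M ι κ : Type*} [CommRing R] [AddCommGroup M]
    [Module R M] [DecidableEq κ] (b : Module.Basis ι R M) (f : ι → κ) :
    DirectSum.IsInternal fun k => Submodule.span R (b '' (f ⁻¹' {k})) := by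
  rw [DirectSum.isInternal_submodule_iff_iSupIndep_and_iSup_eq_top]
  constructor
  · rw [iSupIndep_def]
    intro k
    refine (b.linearIndependent.disjoint_span_image (s := f ⁻¹' {k}) (t := f ⁻¹' {k}ᶜ)
      (by rw [Set.preimage_compl]; exact disjoint_compl_right)).mono_right ?_
    refine iSup₂_le fun j hj => Submodule.span_mono (Set.image_mono (Set.preimage_mono ?_))
    simpa using hj.symm
  · rw [← Submodule.span_iUnion, ← Set.image_iUnion, ← Set.preimage_iUnion]
    simp only [Set.iUnion_of_singleton, Set.preimage_univ, Set.image_univ, b.span_eq]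

/-! ### Blocks, facets and the acyclic part of the matching complex -/

namespace MatchingComplex

open OrientedChain

variable {n : ℕ}

instance : Finite (Block n) :=
  inferInstanceAs (Finite {x : Finset (Fin n) // x.Nonempty ∧ x ≠ Finset.univ})

namespace Block

lemma toFinset_injective : Function.Injective (toFinset : Block n → Finset (Fin n)) :=
  Subtype.val_injective

lemma toFinset_nonempty (x : Block n) : x.toFinset.Nonempty := x.2.1

/-- The block `{m}`. -/
def single (hn : 2 ≤ n) (m : Fin n) : Block n :=
  ⟨{m}, Finset.singleton_nonempty m, fun h => by
    have := congrArg Finset.card h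
    simp at this
    omega⟩

@[simp] lemma toFinset_single (hn : 2 ≤ n) (m : Fin n) : (single hn m).toFinset = {m} := rfl

lemma eq_single (hn : 2 ≤ n) {x : Block n} {m : Fin n} (hm : m ∈ x.toFinset)
    (hx : x.toFinset.card = 1) : x = single hn m := by
  obtain ⟨a, ha⟩ := Finset.card_eq_one.1 hx
  rw [ha, Finset.mem_singleton] at hm
  exact toFinset_injective (by rw [ha, toFinset_single, hm])

end Block

/-! ### Facets and homology facets -/

/-- The blocks in `s` are pairwise disjoint. -/
def IsDisjointFamily (s : Finset (Block n)) : Prop :=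
  ∀ x ∈ s, ∀ y ∈ s, x ≠ y → Disjoint x.toFinset y.toFinset

lemma IsDisjointFamily.mono {s t : Finset (Block n)} (ht : IsDisjointFamily t) (h : s ⊆ t) :
    IsDisjointFamily s :=
  fun x hx y hy => ht x (h hx) y (h hy)

lemma IsDisjointFamily.eq_of_mem {s : Finset (Block n)} (hs : IsDisjointFamily s) {x y : Block n}
    (hx : x ∈ s) (hy : y ∈ s) {m : Fin n} (hmx : m ∈ x.toFinset) (hmy : m ∈ y.toFinset) :
    x = y := by
  by_contra h
  exact Finset.disjoint_left.1 (hs x hx y hy h) hmx hmy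

lemma isDisjointFamily_insert {s : Finset (Block n)} (hs : IsDisjointFamily s) {x : Block n}
    (hx : ∀ y ∈ s, x ≠ y → Disjoint x.toFinset y.toFinset) : IsDisjointFamily (insert x s) := by
  intro y hy z hz hyz
  rcases Finset.mem_insert.1 hy with rfl | hy'
  · exact hx z (Finset.mem_of_mem_insert_of_ne hz hyz.symm) hyz
  · rcases Finset.mem_insert.1 hz with rfl | hz'
    · exact (hx y hy' hyz.symm).symm
    · exact hs y hy' z hz' hyz

lemma mem_faces_iff {s : Finset (Block n)} :
    s ∈ (complex n).faces ↔ s.Nonempty ∧ IsDisjointFamily s := Iff.rfl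

lemma eq_empty_or_mem_faces_iff {s : Finset (Block n)} :
    s = ∅ ∨ s ∈ (complex n).faces ↔ IsDisjointFamily s := by
  rcases s.eq_empty_or_nonempty with rfl | h
  · simp [IsDisjointFamily]
  · simp [mem_faces_iff, h, h.ne_empty]

/-- If a non-empty face leaves elements uncovered, the set of all of these is a proper block that
can be added; if it covers everything, any further block would meet an existing one. -/
lemma isFacet_iff {s : Finset (Block n)} :
    IsFacet (complex n) s ↔ s ∈ (complex n).faces ∧ ∀ m, ∃ x ∈ s, m ∈ x.toFinset := by
  refine ⟨fun h => ⟨h.prop, ?_⟩, fun h => ⟨h.1, fun t ht hst x hx => ?_⟩⟩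
  · by_contra! hm
    obtain ⟨m, hm⟩ := hm
    obtain ⟨x₀, hx₀⟩ := h.prop.1
    obtain ⟨a, ha⟩ := x₀.toFinset_nonempty
    let c : Block n := ⟨(s.biUnion Block.toFinset)ᶜ, ⟨m, by simpa using hm⟩, fun hu => by
      have : a ∈ (s.biUnion Block.toFinset)ᶜ := hu ▸ Finset.mem_univ a
      rw [Finset.mem_compl, Finset.mem_biUnion] at this
      exact this ⟨x₀, hx₀, ha⟩⟩
    have hc : c.toFinset = (s.biUnion Block.toFinset)ᶜ := rfl
    have hface : insert c s ∈ (complex n).faces := by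
      refine ⟨Finset.insert_nonempty _ _, isDisjointFamily_insert h.prop.2 fun y hy _ => ?_⟩
      rw [hc, Finset.disjoint_left]
      intro b hb hby
      exact Finset.mem_compl.1 hb (Finset.mem_biUnion.2 ⟨y, hy, hby⟩)
    refine hm c (h.le_of_ge hface (Finset.subset_insert c s) (Finset.mem_insert_self c s)) ?_
    simpa [hc] using hm
  · obtain ⟨m, hm⟩ := x.toFinset_nonempty
    obtain ⟨y, hy, hmy⟩ := h.2 m
    rwa [IsDisjointFamily.eq_of_mem ht.2 hx (hst hy) hm hmy]

lemma exists_isFacet_subset {s : Finset (Block n)} (hs : s ∈ (complex n).faces) :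
    ∃ t, IsFacet (complex n) t ∧ s ⊆ t := by
  obtain ⟨t, hst, ht⟩ := (Set.toFinite (complex n).faces).exists_le_maximal hs
  exact ⟨t, ht, hst⟩

/-- A singleton block cannot be exchanged, since the remaining blocks leave only one element to
cover. A larger block can be replaced by a singleton inside it; when no block is a singleton, every
facet completing this comes earlier in the order. -/
theorem isHomologyFacet_iff (hn : 2 ≤ n) {r : Finset (Block n) → Finset (Block n) → Prop}
    (hr : IsFacetOrder n r) {s : Finset (Block n)} :
    IsHomologyFacet (complex n) r s ↔
      IsFacet (complex n) s ∧ ∀ x ∈ s, x.toFinset.card ≠ 1 := by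
  refine and_congr_right fun hs => ?_
  obtain ⟨hface, hcov⟩ := isFacet_iff.1 hs
  refine ⟨fun h x hx hx1 => ?_, fun h => Set.Subset.antisymm (fun x hx => hx.1) fun x hx => ⟨hx, ?_⟩⟩
  · have hxs : x ∈ restrictionSet (complex n) r s := by rw [h]; exact hx
    obtain ⟨-, t, ht, hrt, hst⟩ := hxs
    obtain ⟨m, hm⟩ := Finset.card_eq_one.1 hx1
    have hmx : m ∈ x.toFinset := by simp [hm]
    obtain ⟨y, hy, hmy⟩ := (isFacet_iff.1 ht).2 m
    -- All other blocks of `s` lie in `t`, so the block of `t` through `m` must avoid them.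
    have hyx : y.toFinset ⊆ x.toFinset := by
      intro a ha
      obtain ⟨z, hz, haz⟩ := hcov a
      by_contra hax
      have hzx : z ≠ x := fun h => hax (h ▸ haz)
      have hyz := IsDisjointFamily.eq_of_mem ht.prop.2 hy (hst (Finset.mem_erase.2 ⟨hzx, hz⟩)) ha haz
      exact hzx (IsDisjointFamily.eq_of_mem hface.2 hz hx (hyz ▸ hmy) hmx)
    have hyx' : y = x := Block.toFinset_injective <| by
      rw [hm] at hyx ⊢
      exact (Finset.Nonempty.subset_singleton_iff y.toFinset_nonempty).1 hyx
    have hsub : s ⊆ t := by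
      rw [← Finset.insert_erase hx]
      exact Finset.insert_subset (hyx' ▸ hy) hst
    have heq : s = t := Finset.Subset.antisymm hsub (hs.le_of_ge ht.prop hsub)
    exact hr.irrefl s hs (heq ▸ hrt)
  · obtain ⟨m, hm⟩ := x.toFinset_nonempty
    have hf : insert (Block.single hn m) (s.erase x) ∈ (complex n).faces := by
      refine ⟨Finset.insert_nonempty _ _, isDisjointFamily_insert
        (IsDisjointFamily.mono hface.2 (Finset.erase_subset x s)) fun y hy _ => ?_⟩
      rw [Block.toFinset_single, Finset.disjoint_singleton_left]
      intro hmy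
      exact (Finset.mem_erase.1 hy).1
        (IsDisjointFamily.eq_of_mem hface.2 (Finset.mem_erase.1 hy).2 hx hmy hm)
    obtain ⟨t, ht, hst⟩ := exists_isFacet_subset hf
    refine ⟨t, ht, hr.singletons_lt t s ht hs ?_, (Finset.subset_insert _ _).trans hst⟩
    have h0 : singletons s = 0 := by
      rw [singletons, Finset.card_eq_zero, Finset.filter_eq_empty_iff]
      exact h
    rw [h0, singletons, Finset.card_pos]
    exact ⟨Block.single hn m, Finset.mem_filter.2 ⟨hst (Finset.mem_insert_self _ _), by simp⟩⟩

/-! ### Acyclicity of the complement of the homology facets -/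

/-- The elements of `[n]` that lie in no block of `s` of size at least two. -/
def freeElements (s : Finset (Block n)) : Finset (Fin n) :=
  Finset.univ.filter fun m => ∀ x ∈ s, m ∈ x.toFinset → x.toFinset.card = 1

lemma mem_freeElements {s : Finset (Block n)} {m : Fin n} :
    m ∈ freeElements s ↔ ∀ x ∈ s, m ∈ x.toFinset → x.toFinset.card = 1 := by
  simp [freeElements]

lemma freeElements_anti {s t : Finset (Block n)} (h : s ⊆ t) : freeElements t ⊆ freeElements s :=
  fun _ hm => mem_freeElements.2 fun x hx => mem_freeElements.1 hm x (h hx)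

lemma freeElements_insert {x : Block n} (hx : x.toFinset.card = 1) (s : Finset (Block n)) :
    freeElements (insert x s) = freeElements s := by
  ext m
  simp [mem_freeElements, hx]

/-- The number of blocks of size at least two. -/
def nonsingletons (s : Finset (Block n)) : ℕ :=
  (s.filter fun x => x.toFinset.card ≠ 1).card

lemma nonsingletons_insert {x : Block n} (hx : x.toFinset.card = 1) (s : Finset (Block n)) :
    nonsingletons (insert x s) = nonsingletons s := by
  rw [nonsingletons, Finset.filter_insert, if_neg (by simpa using hx), nonsingletons]

/-- A face is not a homology facet exactly if some element of `[n]` is free. -/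
lemma freeElements_nonempty_iff {s : Finset (Block n)} (hs : s ∈ (complex n).faces) :
    (freeElements s).Nonempty ↔
      ¬ (IsFacet (complex n) s ∧ ∀ x ∈ s, x.toFinset.card ≠ 1) := by
  rw [isFacet_iff, and_iff_right hs]
  constructor
  · rintro ⟨m, hm⟩ ⟨hcov, h1⟩
    obtain ⟨x, hx, hmx⟩ := hcov m
    exact h1 x hx (mem_freeElements.1 hm x hx hmx)
  · intro h
    by_contra hf
    have hf' : ∀ m, ∃ x ∈ s, m ∈ x.toFinset ∧ x.toFinset.card ≠ 1 := by
      simpa [Finset.Nonempty, mem_freeElements] using hf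
    refine h ⟨fun m => ?_, fun x hx => ?_⟩
    · obtain ⟨x, hx, hmx, -⟩ := hf' m
      exact ⟨x, hx, hmx⟩
    · obtain ⟨m, hm⟩ := x.toFinset_nonempty
      obtain ⟨y, hy, hmy, hy1⟩ := hf' m
      rwa [IsDisjointFamily.eq_of_mem hs.2 hx hy hm hmy]

/-- The block `{m}`, where `m` is the least free element. -/
def apex (hn : 2 ≤ n) (s : Finset (Block n)) : Block n :=
  -- The default `0` is immaterial: only simplices with a free element enter the cone argument.
  Block.single hn <| if h : (freeElements s).Nonempty then (freeElements s).min' h else ⟨0, by omega⟩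

lemma apex_congr (hn : 2 ≤ n) {s t : Finset (Block n)} (h : freeElements s = freeElements t) :
    apex hn s = apex hn t := by
  unfold apex
  rw [h]

lemma card_apex (hn : 2 ≤ n) (s : Finset (Block n)) : (apex hn s).toFinset.card = 1 := by
  simp [apex]

lemma isDisjointFamily_insert_apex (hn : 2 ≤ n) {s : Finset (Block n)} (hs : IsDisjointFamily s)
    (hf : (freeElements s).Nonempty) : IsDisjointFamily (insert (apex hn s) s) := by
  refine isDisjointFamily_insert hs fun y hy hne => ?_
  rw [apex, dif_pos hf] at hne ⊢
  rw [Block.toFinset_single, Finset.disjoint_singleton_left]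
  exact fun hm => hne
    (Block.eq_single hn hm (mem_freeElements.1 (Finset.min'_mem _ hf) y hy hm)).symm

/-- Deleting a singleton block changes neither the free elements nor the apex, while deleting a
larger block lowers `nonsingletons`, and adding back the old apex, a singleton, does not raise it.
This is the filtration required by `exists_boundary_eq`. The empty simplex is allowed, so `k = 0` is
covered. -/
theorem exists_boundary_eq_of_freeElements_nonempty (hn : 2 ≤ n) {k : ℕ}
    {c : Finset (Block n) →₀ ℤ}
    (hc : c ∈ Finsupp.supported ℤ ℤ
      {s | (IsDisjointFamily s ∧ (freeElements s).Nonempty) ∧ s.card = k})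
    (hcycle : boundary (Block n) c = 0) :
    ∃ b ∈ Finsupp.supported ℤ ℤ
      {s | (IsDisjointFamily s ∧ (freeElements s).Nonempty) ∧ s.card = k + 1},
      boundary (Block n) b = c := by
  refine exists_boundary_eq {s | IsDisjointFamily s ∧ (freeElements s).Nonempty} nonsingletons
    (apex hn) ?_ ?_ hc hcycle
  · rintro s ⟨hs, hf⟩
    exact ⟨⟨isDisjointFamily_insert_apex hn hs hf, by rwa [freeElements_insert (card_apex hn s)]⟩,
      nonsingletons_insert (card_apex hn s) s⟩
  · rintro s ⟨hs, hf⟩ x hx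
    refine ⟨⟨hs.mono (Finset.erase_subset x s), hf.mono (freeElements_anti (Finset.erase_subset x s))⟩,
      ?_⟩
    by_cases hx1 : x.toFinset.card = 1
    · left
      rw [← nonsingletons_insert hx1 (s.erase x)]
      have := freeElements_insert hx1 (s.erase x)
      rw [Finset.insert_erase hx] at this ⊢
      exact ⟨rfl, apex_congr hn this.symm⟩
    · right
      have hlt : nonsingletons (s.erase x) < nonsingletons s := by
        refine Finset.card_lt_card (Finset.ssubset_iff_subset_ne.2
          ⟨Finset.filter_subset_filter _ (Finset.erase_subset x s), fun h => ?_⟩)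
        have : x ∈ s.filter fun x => x.toFinset.card ≠ 1 := Finset.mem_filter.2 ⟨hx, hx1⟩
        rw [← h] at this
        simp at this
      refine ⟨hlt, ⟨?_, ?_⟩, ?_⟩
      · exact (isDisjointFamily_insert_apex hn hs hf).mono
          (Finset.insert_subset_insert _ (Finset.erase_subset x s))
      · rw [freeElements_insert (card_apex hn s)]
        exact hf.mono (freeElements_anti (Finset.erase_subset x s))
      · rwa [nonsingletons_insert (card_apex hn s)]

end MatchingComplex

/-! ### Coefficients of chains at facets -/

namespace OrientedChain

variable {V : Type*} [LinearOrder V]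

lemma orientationSign_mul_self {G : Type*} [Group G] [MulAction G V] (g : G) (s : Finset V) :
    orientationSign g s * orientationSign g s = 1 := by
  rw [orientationSign, ← mul_pow]
  simp

lemma action_apply_smul {G : Type*} [Group G] [MulAction G V] (g : G) (c : Finset V →₀ ℤ)
    (s : Finset V) : action G V g c (g • s) = orientationSign g s * c s := by
  suffices h : Finsupp.lapply (g • s) ∘ₗ action G V g =
      orientationSign g s • Finsupp.lapply (R := ℤ) (M := ℤ) s from LinearMap.congr_fun h c
  ext t : 2
  simp only [LinearMap.comp_apply, Finsupp.lsingle_apply, action_single, LinearMap.smul_apply,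
    Finsupp.lapply_apply, Finsupp.single_apply, smul_left_cancel_iff]
  split_ifs with h
  · simp [h]
  · simp

lemma mem_faces_of_mem_chains {V : Type*} {X : AbstractSimplicialComplex V} {k : ℕ}
    {c : Finset V →₀ ℤ} (hc : c ∈ chains X k) {s : Finset V} (hs : c s ≠ 0) :
    s.card = k ∧ (s = ∅ ∨ s ∈ X.faces) :=
  hc (Finsupp.mem_support_iff.2 hs)

/-- A simplex occurring in the boundary of a face is properly contained in that face, so it is not
maximal. Hence coefficients at facets depend only on the homology class of a cycle. -/
lemma boundary_apply_of_isFacet {X : AbstractSimplicialComplex V} {k : ℕ} {c : Finset V →₀ ℤ}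
    (hc : c ∈ chains X k) {s : Finset V} (hs : IsFacet X s) : boundary V c s = 0 := by
  suffices h : chains X k ≤ LinearMap.ker (Finsupp.lapply (R := ℤ) (M := ℤ) s ∘ₗ boundary V) from
    h hc
  rw [chains, Finsupp.supported_eq_span_single, Submodule.span_le]
  rintro _ ⟨t, ⟨-, ht⟩, rfl⟩
  rw [SetLike.mem_coe, LinearMap.mem_ker, LinearMap.comp_apply, boundary_single_one, map_sum]
  refine Finset.sum_eq_zero fun x hx => ?_
  rw [Finsupp.lapply_apply, Finsupp.single_apply, if_neg]
  rintro rfl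
  rcases ht with rfl | ht
  · simp at hx
  · exact Finset.notMem_erase x t (hs.le_of_ge ht (Finset.erase_subset x t) hx)

end OrientedChain

/-! ### The basis of the homology dual to the homology facets -/

namespace MatchingComplex

open OrientedChain

variable {n : ℕ}

/-- The facets with `q + 1` blocks, none of which is a singleton. -/
def HomologyFacet (n q : ℕ) : Type :=
  {s : Finset (Block n) //
    (IsFacet (complex n) s ∧ ∀ x ∈ s, x.toFinset.card ≠ 1) ∧ s.card = q + 1}

instance (q : ℕ) : Finite (HomologyFacet n q) :=
  inferInstanceAs (Finite {_s : Finset (Block n) // _})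

/-- The coefficients of a homology class at the homology facets. -/
def homologyCoeff (n q : ℕ) : Homology (complex n) q →ₗ[ℤ] (HomologyFacet n q → ℤ) :=
  Submodule.liftQ _
    (LinearMap.pi fun s => Finsupp.lapply s.1 ∘ₗ (cycles (complex n) q).subtype) <| by
      rintro z ⟨b, hb, hbz⟩
      rw [LinearMap.mem_ker]
      funext s
      change (z : Finset (Block n) →₀ ℤ) s.1 = 0
      rw [← boundary_apply_of_isFacet hb s.2.1.1, hbz]
      rfl

lemma homologyCoeff_mk (q : ℕ) (z : cycles (complex n) q) (s : HomologyFacet n q) :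
    homologyCoeff n q (Submodule.Quotient.mk z) s = (z : Finset (Block n) →₀ ℤ) s.1 := rfl

/-- A cycle vanishing at every homology facet is supported on faces with a free element, where
acyclicity makes it a boundary. -/
lemma homologyCoeff_injective (hn : 2 ≤ n) (q : ℕ) :
    Function.Injective (homologyCoeff n q) := by
  rw [injective_iff_map_eq_zero]
  intro h h0
  obtain ⟨z, rfl⟩ := Submodule.Quotient.mk_surjective _ h
  rw [Submodule.Quotient.mk_eq_zero]
  obtain ⟨b, hb, hbz⟩ := exists_boundary_eq_of_freeElements_nonempty hn (k := q + 1)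
    (c := (z : Finset (Block n) →₀ ℤ)) (fun s hs => by
      have hs0 := Finsupp.mem_support_iff.1 hs
      obtain ⟨hcard, hs'⟩ := mem_faces_of_mem_chains z.2.1 hs0
      have hne : s ≠ ∅ := by
        rintro rfl
        simp at hcard
      have hface := hs'.resolve_left hne
      refine ⟨⟨hface.2, (freeElements_nonempty_iff hface).2 fun hHF => hs0 ?_⟩, hcard⟩
      exact congrFun h0 ⟨s, hHF, hcard⟩) z.2.2
  refine ⟨b, fun s hs => ?_, hbz⟩
  obtain ⟨⟨hs1, -⟩, hs2⟩ := hb hs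
  exact ⟨hs2, eq_empty_or_mem_faces_iff.2 hs1⟩

/-- Removing a block from `s` frees its elements, so the boundary of `s` is a cycle in the acyclic
part. Fill it there by `b`: the cycle is `s - b`, and `b` has no homology facet in its support. -/
lemma exists_cycle_of_homologyFacet (hn : 2 ≤ n) {q : ℕ} (s : HomologyFacet n q) :
    ∃ z : cycles (complex n) q, (z : Finset (Block n) →₀ ℤ) s.1 = 1 ∧
      ∀ t : HomologyFacet n q, t ≠ s → (z : Finset (Block n) →₀ ℤ) t.1 = 0 := by
  classical
  obtain ⟨s, ⟨hs, hs1⟩, hcard⟩ := s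
  obtain ⟨b, hb, hbs⟩ := exists_boundary_eq_of_freeElements_nonempty hn (k := q)
    (c := boundary (Block n) (Finsupp.single s 1)) (by
      rw [boundary_single_one]
      refine Submodule.sum_mem _ fun x hx => Finsupp.single_mem_supported ℤ _ ⟨⟨?_, ?_⟩, ?_⟩
      · exact IsDisjointFamily.mono hs.prop.2 (Finset.erase_subset x s)
      · obtain ⟨m, hm⟩ := x.toFinset_nonempty
        refine ⟨m, mem_freeElements.2 fun y hy hmy => ?_⟩
        exact absurd (IsDisjointFamily.eq_of_mem hs.prop.2 (Finset.mem_erase.1 hy).2 hx hmy hm)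
          (Finset.mem_erase.1 hy).1
      · rw [Finset.card_erase_of_mem hx, hcard, Nat.add_sub_cancel]) (boundary_boundary _)
  have hb0 : ∀ t : HomologyFacet n q, b t.1 = 0 := by
    intro t
    by_contra ht
    obtain ⟨⟨-, hf⟩, -⟩ := hb (Finsupp.mem_support_iff.2 ht)
    exact (freeElements_nonempty_iff t.2.1.1.prop).1 hf t.2.1
  refine ⟨⟨Finsupp.single s 1 - b, sub_mem (Finsupp.single_mem_supported ℤ _
    ⟨hcard, Or.inr hs.prop⟩) fun t ht => ?_, ?_⟩, ?_, fun t hts => ?_⟩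
  · obtain ⟨⟨ht1, -⟩, ht2⟩ := hb ht
    exact ⟨ht2, eq_empty_or_mem_faces_iff.2 ht1⟩
  · rw [SetLike.mem_coe, LinearMap.mem_ker, map_sub, hbs, sub_self]
  · have := hb0 ⟨s, ⟨hs, hs1⟩, hcard⟩
    simp only at this
    simp [this]
  · have hne : s ≠ t.1 := fun h => hts (Subtype.ext h.symm)
    simp [hb0, hne]

lemma homologyCoeff_surjective (hn : 2 ≤ n) (q : ℕ) :
    Function.Surjective (homologyCoeff n q) := by
  classical
  have := Fintype.ofFinite (HomologyFacet n q)
  intro f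
  choose z hz1 hz0 using exists_cycle_of_homologyFacet hn (q := q)
  refine ⟨∑ s, f s • Submodule.Quotient.mk (z s), ?_⟩
  funext t
  rw [map_sum, Finset.sum_apply, Finset.sum_eq_single t]
  · rw [map_smul, Pi.smul_apply, homologyCoeff_mk, hz1, smul_eq_mul, mul_one]
  · intro s _ hst
    rw [map_smul, Pi.smul_apply, homologyCoeff_mk, hz0 s t hst.symm, smul_zero]
  · simp

/-- The classes corresponding to the homology facets form a basis of the homology. -/
def homologyBasis (hn : 2 ≤ n) (q : ℕ) :
    Module.Basis (HomologyFacet n q) ℤ (Homology (complex n) q) :=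
  Module.Basis.ofEquivFun (LinearEquiv.ofBijective (homologyCoeff n q)
    ⟨homologyCoeff_injective hn q, homologyCoeff_surjective hn q⟩)

open Classical in
lemma homologyCoeff_homologyBasis (hn : 2 ≤ n) {q : ℕ} (s : HomologyFacet n q) :
    homologyCoeff n q (homologyBasis hn q s) = Pi.single s 1 := by
  rw [homologyBasis, Module.Basis.coe_ofEquivFun]
  exact LinearEquiv.apply_symm_apply (LinearEquiv.ofBijective (homologyCoeff n q) _) _

/-- The prescribed coefficients determine the class, by injectivity of `homologyCoeff`. So the class
of a homology facet is well defined and does not depend on the facet order. -/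
lemma isFacetClass_iff (hn : 2 ≤ n) {r : Finset (Block n) → Finset (Block n) → Prop}
    (hr : IsFacetOrder n r) {q : ℕ} (s : HomologyFacet n q) (h : Homology (complex n) q) :
    IsFacetClass (complex n) r q s.1 h ↔ h = homologyBasis hn q s := by
  classical
  have key : h = homologyBasis hn q s ↔
      ∀ t, homologyCoeff n q h t = Pi.single (M := fun _ => ℤ) s 1 t := by
    rw [← (homologyCoeff_injective hn q).eq_iff, homologyCoeff_homologyBasis, funext_iff]
  rw [key]
  constructor
  · rintro ⟨z, rfl, hz1, hz0⟩ t
    by_cases hts : t = s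
    · rw [hts, Pi.single_eq_same, homologyCoeff_mk, hz1]
    · rw [Pi.single_eq_of_ne hts, homologyCoeff_mk]
      exact hz0 t.1 ((isHomologyFacet_iff hn hr).2 t.2.1) t.2.2 fun h => hts (Subtype.ext h)
  · intro ht
    obtain ⟨z, rfl⟩ := Submodule.Quotient.mk_surjective _ h
    refine ⟨z, rfl, ?_, fun t htH htc hts => ?_⟩
    · rw [← homologyCoeff_mk, ht, Pi.single_eq_same]
    · let t' : HomologyFacet n q := ⟨t, (isHomologyFacet_iff hn hr).1 htH, htc⟩
      have hne : t' ≠ s := fun h => hts (congrArg Subtype.val h)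
      exact (ht t').trans (Pi.single_eq_of_ne hne 1)

/-! ### The action of the symmetric group on the facets -/

lemma isFacet_smul (g : Equiv.Perm (Fin n)) {s : Finset (Block n)} (hs : IsFacet (complex n) s) :
    IsFacet (complex n) (g • s) := by
  refine ⟨smul_mem_complex n g s hs.prop, fun t ht hst => ?_⟩
  have h := hs.le_of_ge (smul_mem_complex n g⁻¹ t ht) (by
    rw [← inv_smul_smul g s]
    exact Finset.smul_finset_subset_smul_finset hst)
  rw [← smul_inv_smul g t]
  exact Finset.smul_finset_subset_smul_finset h

lemma Block.card_smul (g : Equiv.Perm (Fin n)) (x : Block n) :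
    (g • x).toFinset.card = x.toFinset.card := by
  rw [Block.toFinset_smul, Finset.card_smul_finset]

instance (q : ℕ) : MulAction (Equiv.Perm (Fin n)) (HomologyFacet n q) where
  smul g s := ⟨g • s.1, ⟨isFacet_smul g s.2.1.1, fun x hx => by
    obtain ⟨y, hy, rfl⟩ := Finset.mem_smul_finset.1 hx
    rw [Block.card_smul]
    exact s.2.1.2 y hy⟩, by rw [Finset.card_smul_finset, s.2.2]⟩
  one_smul s := Subtype.ext (one_smul _ s.1)
  mul_smul g h s := Subtype.ext (mul_smul g h s.1)

lemma homologyCoeff_homologyRep (q : ℕ) (g : Equiv.Perm (Fin n)) (h : Homology (complex n) q)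
    (s : HomologyFacet n q) :
    homologyCoeff n q (homologyRep n q g h) (g • s) =
      orientationSign g s.1 * homologyCoeff n q h s := by
  obtain ⟨z, rfl⟩ := Submodule.Quotient.mk_surjective _ h
  exact action_apply_smul g (z : Finset (Block n) →₀ ℤ) s.1

/-- Both sides have the same coefficients at the homology facets, and these determine a class. -/
lemma homologyRep_homologyBasis (hn : 2 ≤ n) {q : ℕ} (g : Equiv.Perm (Fin n))
    (s : HomologyFacet n q) :
    homologyRep n q g (homologyBasis hn q s) =
      orientationSign g s.1 • homologyBasis hn q (g • s) := by
  classical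
  refine homologyCoeff_injective hn q (funext fun t => ?_)
  obtain ⟨t, rfl⟩ : ∃ t', g • t' = t := ⟨g⁻¹ • t, smul_inv_smul g t⟩
  rw [homologyCoeff_homologyRep, map_smul, homologyCoeff_homologyBasis,
    homologyCoeff_homologyBasis, Pi.smul_apply, smul_eq_mul]
  by_cases h : t = s
  · rw [h, Pi.single_eq_same, Pi.single_eq_same]
  · rw [Pi.single_eq_of_ne h, Pi.single_eq_of_ne ((MulAction.injective g).ne h), mul_zero, mul_zero]

end MatchingComplex

namespace MatchingComplex

open OrientedChain

variable {n : ℕ}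

/-! ### The standard facet of a given shape -/

lemma parts_eq_singleton {p : n.Partition} (h : n ∈ p.parts) : p.parts = {n} := by
  obtain ⟨t, ht⟩ := Multiset.exists_cons_of_mem h
  have hsum := p.parts_sum
  rw [ht, Multiset.sum_cons] at hsum
  have ht0 : t = 0 := by
    refine Multiset.eq_zero_of_forall_notMem fun a ha => ?_
    have hpos : 0 < a := p.parts_pos (ht ▸ Multiset.mem_cons_of_mem ha)
    have := Multiset.le_sum_of_mem ha
    omega
  rw [ht, ht0]
  rfl

lemma coe_blocks (p : n.Partition) : ((composition p).blocks : Multiset ℕ) = p.parts :=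
  Multiset.sort_eq _ _

lemma card_filter_index (c : Composition n) (i : Fin c.length) :
    (Finset.univ.filter fun m => c.index m = i).card = c.blocksFun i := by
  have : (Finset.univ.filter fun m => c.index m = i) =
      Finset.univ.map (c.embedding i).toEmbedding := by
    ext m
    rw [Finset.mem_filter_univ, eq_comm, ← c.mem_range_embedding_iff']
    simp
  rw [this, Finset.card_map, Finset.card_univ, Fintype.card_fin]

lemma index_lt_imp_lt (c : Composition n) {a b : Fin n} (h : c.index a < c.index b) : a < b := by
  have h1 := c.lt_sizeUpTo_index_succ a
  have h2 := c.sizeUpTo_index_le b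
  have h3 := c.monotone_sizeUpTo (Nat.succ_le_of_lt (Fin.lt_def.1 h))
  rw [Fin.val_succ] at h1
  exact Fin.lt_def.2 (h1.trans_le (h3.trans h2))

lemma blocksFun_antitone (p : n.Partition) : Antitone (composition p).blocksFun := by
  intro i j hij
  have h : (composition p).blocks.Pairwise (· ≥ ·) := Multiset.pairwise_sort _ _
  rcases hij.eq_or_lt with rfl | hlt
  · exact le_rfl
  · exact List.pairwise_iff_get.1 h i j hlt

/-- The `i`-th interval as a block. -/
def stdBlock (p : n.Partition) (hp : p.parts ≠ {n}) (i : Fin (composition p).length) : Block n :=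
  ⟨Finset.univ.filter fun m => (composition p).index m = i,
    ⟨(composition p).embedding i ⟨0, (composition p).one_le_blocksFun i⟩, by simp⟩, fun h => by
      have hc := card_filter_index (composition p) i
      rw [h, Finset.card_univ, Fintype.card_fin] at hc
      refine hp (parts_eq_singleton ?_)
      have := (composition p).blocksFun_mem_blocks i
      rwa [← hc, ← Multiset.mem_coe, coe_blocks] at this⟩

variable (p : n.Partition) (hp : p.parts ≠ {n})

lemma mem_stdBlock {i : Fin (composition p).length} {m : Fin n} :
    m ∈ (stdBlock p hp i).toFinset ↔ (composition p).index m = i := by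
  simp [stdBlock, Block.toFinset]

lemma card_stdBlock (i : Fin (composition p).length) :
    (stdBlock p hp i).toFinset.card = (composition p).blocksFun i :=
  card_filter_index _ i

lemma Block.lt_iff {x y : Block n} : x < y ↔ y.toFinset.card < x.toFinset.card ∨
    x.toFinset.card = y.toFinset.card ∧ x.toFinset.sort (· ≤ ·) < y.toFinset.sort (· ≤ ·) :=
  Prod.Lex.toLex_lt_toLex

/-- The vertex order matches the order of the intervals: sizes decrease weakly, and between
intervals of equal size the least elements decide lexicographically. -/
lemma stdBlock_strictMono : StrictMono (stdBlock p hp) := by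
  intro i j hij
  rw [Block.lt_iff, card_stdBlock, card_stdBlock]
  rcases (blocksFun_antitone p hij.le).lt_or_eq with h | h
  · exact Or.inl h
  · refine Or.inr ⟨h.symm, ?_⟩
    have hmem : ∀ k m, m ∈ (stdBlock p hp k).toFinset.sort (· ≤ ·) →
        (composition p).index m = k := fun k m hm =>
      (mem_stdBlock p hp).1 ((Finset.mem_sort _).1 hm)
    have hne : ∀ k, (stdBlock p hp k).toFinset.sort (· ≤ ·) ≠ [] := by
      intro k hk
      have := congrArg List.toFinset hk
      rw [Finset.sort_toFinset] at this
      exact (stdBlock p hp k).toFinset_nonempty.ne_empty (by simpa using this)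
    obtain ⟨a, l, hal⟩ := List.exists_cons_of_ne_nil (hne i)
    obtain ⟨b, l', hbl⟩ := List.exists_cons_of_ne_nil (hne j)
    rw [hal, hbl]
    refine List.Lex.rel (index_lt_imp_lt (composition p) ?_)
    rwa [hmem i a (by simp [hal]), hmem j b (by simp [hbl])]

/-- The facet formed by the intervals. -/
def stdFacet : Finset (Block n) :=
  Finset.univ.map ⟨stdBlock p hp, (stdBlock_strictMono p hp).injective⟩

lemma mem_stdFacet {x : Block n} : x ∈ stdFacet p hp ↔ ∃ i, stdBlock p hp i = x := by
  simp [stdFacet]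

lemma isFacet_stdFacet (hn : 2 ≤ n) : IsFacet (complex n) (stdFacet p hp) := by
  refine isFacet_iff.2 ⟨⟨?_, ?_⟩, fun m => ⟨_, (mem_stdFacet p hp).2 ⟨(composition p).index m, rfl⟩,
    (mem_stdBlock p hp).2 rfl⟩⟩
  · exact ⟨_, (mem_stdFacet p hp).2 ⟨(composition p).index ⟨0, by omega⟩, rfl⟩⟩
  · intro x hx y hy hxy
    obtain ⟨i, rfl⟩ := (mem_stdFacet p hp).1 hx
    obtain ⟨j, rfl⟩ := (mem_stdFacet p hp).1 hy
    refine Finset.disjoint_left.2 fun m hmi hmj => hxy ?_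
    rw [← (mem_stdBlock p hp).1 hmi, ← (mem_stdBlock p hp).1 hmj]

lemma hasShape_stdFacet : HasShape (stdFacet p hp) p := by
  rw [HasShape, stdFacet, Finset.map_val, Multiset.map_map]
  have : (fun x : Block n => x.toFinset.card) ∘
      ⇑(⟨stdBlock p hp, (stdBlock_strictMono p hp).injective⟩ : _ ↪ Block n) =
      (composition p).blocksFun := funext fun i => card_stdBlock p hp i
  rw [this, ← coe_blocks, ← (composition p).ofFn_blocksFun, Fin.univ_val_map]

lemma smul_stdBlock (g : youngNormalizer p) (i : Fin (composition p).length) :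
    g.1 • stdBlock p hp i = stdBlock p hp (blockPerm p g i) := by
  refine Block.toFinset_injective (Finset.ext fun m => ?_)
  rw [Block.toFinset_smul, Finset.mem_smul_finset, mem_stdBlock]
  constructor
  · rintro ⟨a, ha, rfl⟩
    rw [← (mem_stdBlock p hp).1 ha, blockPerm_index]
    rfl
  · intro h
    refine ⟨g.1⁻¹ m, (mem_stdBlock p hp).2 ((blockPerm p g).injective ?_), by simp⟩
    rw [blockPerm_index, ← h]
    simp

lemma index_apply_eq_of_smul_stdFacet {g : Equiv.Perm (Fin n)}
    (hg : g • stdFacet p hp = stdFacet p hp) {a b : Fin n}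
    (h : (composition p).index a = (composition p).index b) :
    (composition p).index (g a) = (composition p).index (g b) := by
  have h1 : g • stdBlock p hp ((composition p).index a) ∈ stdFacet p hp := by
    rw [← hg]
    exact Finset.smul_mem_smul_finset ((mem_stdFacet p hp).2 ⟨_, rfl⟩)
  obtain ⟨j, hj⟩ := (mem_stdFacet p hp).1 h1
  have h2 : ∀ c, (composition p).index c = (composition p).index a →
      (composition p).index (g c) = j := by
    intro c hc
    rw [← mem_stdBlock p hp, hj, Block.toFinset_smul]
    exact Finset.smul_mem_smul_finset ((mem_stdBlock p hp).2 hc)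
  rw [h2 a rfl, h2 b h.symm]

/-- The normaliser permutes the intervals, so it fixes the facet. Conversely, a permutation fixing
the facet preserves the relation of lying in a common interval, so conjugation by it and by its
inverse preserves the Young subgroup. -/
lemma mem_youngNormalizer_iff (g : Equiv.Perm (Fin n)) :
    g ∈ youngNormalizer p ↔ g • stdFacet p hp = stdFacet p hp := by
  constructor
  · intro hg
    refine Finset.eq_of_subset_of_card_le (fun x hx => ?_) (Finset.card_smul_finset _ _).ge
    obtain ⟨y, hy, rfl⟩ := Finset.mem_smul_finset.1 hx
    obtain ⟨i, rfl⟩ := (mem_stdFacet p hp).1 hy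
    exact (mem_stdFacet p hp).2 ⟨_, (smul_stdBlock p hp ⟨g, hg⟩ i).symm⟩
  · intro hg
    have hg' : g⁻¹ • stdFacet p hp = stdFacet p hp := by
      nth_rewrite 1 [← hg]
      rw [inv_smul_smul]
    have key : ∀ u : Equiv.Perm (Fin n), u • stdFacet p hp = stdFacet p hp →
        ∀ h ∈ youngSubgroup p, u * h * u⁻¹ ∈ youngSubgroup p := by
      intro u hu h hh m
      have := index_apply_eq_of_smul_stdFacet p hp hu (hh (u⁻¹ m))
      simpa using this
    refine Subgroup.mem_normalizer_iff.2 fun h => ⟨key g hg h, fun hh => ?_⟩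
    have := key g⁻¹ hg' _ hh
    simpa [mul_assoc] using this

/-- Since the intervals are numbered in the order of the vertices, the inversions counted by the
orientation sign are those of the induced permutation of the indices. -/
lemma orientationSign_stdFacet (g : youngNormalizer p) :
    orientationSign g.1 (stdFacet p hp) = (Equiv.Perm.sign (blockPerm p g) : ℤ) := by
  rw [orientationSign_eq_prod, stdFacet, Finset.prod_map, Equiv.Perm.sign_eq_prod_prod_Ioi,
    Units.coe_prod]
  refine Finset.prod_congr rfl fun i _ => ?_
  rw [Finset.prod_map, Units.coe_prod, ← Finset.filter_lt_eq_Ioi, Finset.prod_filter]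
  refine Finset.prod_congr rfl fun j _ => ?_
  simp only [Function.Embedding.coeFn_mk, smul_stdBlock, (stdBlock_strictMono p hp).lt_iff_lt]
  by_cases hij : i < j
  · have hne : blockPerm p g i ≠ blockPerm p g j := (blockPerm p g).injective.ne hij.ne
    rcases lt_or_gt_of_ne hne with h | h <;> simp [hij, h, h.not_gt]
  · simp [hij]

/-- List the blocks of `s` in increasing vertex order. Their sizes then decrease weakly, so they
form the same sorted list as the parts of `p`. -/
lemma exists_enumeration_of_hasShape {s : Finset (Block n)} (hs : HasShape s p) :
    ∃ f : Fin (composition p).length → Block n, (∀ x, x ∈ s ↔ ∃ i, f i = x) ∧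
      Function.Injective f ∧ ∀ i, (f i).toFinset.card = (composition p).blocksFun i := by
  have hblocks : (composition p).blocks = (s.sort (· ≤ ·)).map fun x => x.toFinset.card := by
    refine List.Perm.eq_of_pairwise' (r := (· ≥ ·)) (Multiset.pairwise_sort _ _) ?_ ?_
    · refine List.pairwise_map.2 ((Finset.pairwise_sort s (· ≤ ·)).imp fun {x y} hxy => ?_)
      rcases hxy.eq_or_lt with rfl | hlt
      · exact le_rfl
      · rcases Block.lt_iff.1 hlt with h | h
        · exact h.le
        · exact h.1.ge
    · rw [← Multiset.coe_eq_coe, coe_blocks, ← hs, ← Multiset.map_coe, Finset.sort_eq]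
  have hcard : s.card = (composition p).length := by
    have := congrArg List.length hblocks
    rw [List.length_map, Finset.length_sort] at this
    exact this.symm
  refine ⟨s.orderEmbOfFin hcard, fun x => ?_, (s.orderEmbOfFin hcard).injective, fun i => ?_⟩
  · rw [← Finset.mem_coe, ← Finset.range_orderEmbOfFin s hcard, Set.mem_range]
  · rw [Finset.orderEmbOfFin_apply, Composition.blocksFun, List.get_eq_getElem]
    simp [hblocks]

lemma exists_smul_stdFacet_eq (hn : 2 ≤ n) {s : Finset (Block n)} (hs : IsFacet (complex n) s)
    (hsp : HasShape s p) : ∃ g : Equiv.Perm (Fin n), g • stdFacet p hp = s := by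
  obtain ⟨f, hfs, hf, hcard⟩ := exists_enumeration_of_hasShape p hsp
  have hex : ∀ m, ∃ i, m ∈ (f i).toFinset := by
    intro m
    obtain ⟨x, hx, hm⟩ := (isFacet_iff.1 hs).2 m
    obtain ⟨i, rfl⟩ := (hfs x).1 hx
    exact ⟨i, hm⟩
  choose idx hidx using hex
  have hidx_iff : ∀ m i, idx m = i ↔ m ∈ (f i).toFinset := by
    refine fun m i => ⟨fun h => h ▸ hidx m, fun h => hf ?_⟩
    exact IsDisjointFamily.eq_of_mem hs.prop.2 ((hfs _).2 ⟨_, rfl⟩) ((hfs _).2 ⟨_, rfl⟩) (hidx m) h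
  have hfib : ∀ i, Fintype.card {m // (composition p).index m = i} =
      Fintype.card {m // idx m = i} := by
    intro i
    rw [Fintype.card_subtype, Fintype.card_subtype, card_filter_index, ← hcard]
    congr 1
    ext m
    simp [hidx_iff]
  -- Glue arbitrary bijections from the `i`-th interval onto the `i`-th block of `s`.
  let g : Equiv.Perm (Fin n) := Equiv.ofFiberEquiv fun i => Fintype.equivOfCardEq (hfib i)
  have hg : ∀ m, idx (g m) = (composition p).index m := Equiv.ofFiberEquiv_map _
  have hgf : ∀ i, g • stdBlock p hp i = f i := by
    refine fun i => Block.toFinset_injective (Finset.eq_of_subset_of_card_le (fun m hm => ?_) ?_)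
    · rw [Block.toFinset_smul] at hm
      obtain ⟨a, ha, rfl⟩ := Finset.mem_smul_finset.1 hm
      rw [← hidx_iff]
      exact (hg a).trans ((mem_stdBlock p hp).1 ha)
    · rw [Block.card_smul, card_stdBlock, hcard]
  -- Maximality of the translated facet reduces equality to one inclusion.
  refine ⟨g, (isFacet_smul g (isFacet_stdFacet p hp hn)).eq_of_le hs.prop fun x hx => ?_⟩
  obtain ⟨y, hy, rfl⟩ := Finset.mem_smul_finset.1 hx
  obtain ⟨i, rfl⟩ := (mem_stdFacet p hp).1 hy
  exact (hfs _).2 ⟨i, (hgf i).symm⟩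

end MatchingComplex

/-! ### Submodules spanned by the facets of a given shape -/

namespace MatchingComplex

open OrientedChain

variable {n : ℕ}

lemma hasShape_smul (g : Equiv.Perm (Fin n)) {s : Finset (Block n)} {p : n.Partition}
    (hs : HasShape s p) : HasShape (g • s) p := by
  rw [HasShape, Finset.smul_finset_def,
    Finset.image_val_of_injOn (MulAction.injective g).injOn, Multiset.map_map, ← hs]
  exact Multiset.map_congr rfl fun x _ => Block.card_smul g x

lemma HasShape.card_eq {s : Finset (Block n)} {p : n.Partition} (hs : HasShape s p) :
    s.card = p.parts.card := by
  rw [← hs, Multiset.card_map, Finset.card_val]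

/-- The facets of shape `p`. -/
def ShapeFacet (p : n.Partition) : Type :=
  {s : Finset (Block n) // IsFacet (complex n) s ∧ HasShape s p}

instance (p : n.Partition) : MulAction (Equiv.Perm (Fin n)) (ShapeFacet p) where
  smul g s := ⟨g • s.1, isFacet_smul g s.2.1, hasShape_smul g s.2.2⟩
  one_smul s := Subtype.ext (one_smul _ s.1)
  mul_smul g h s := Subtype.ext (mul_smul g h s.1)

/-- A representation on a linearly independent family indexed by the facets of shape `p`, which
are permuted with the signs coming from their orientations, is induced from `signRep p`. -/
theorem exists_subrepresentation_equiv_inducedRep (hn : 2 ≤ n) {p : n.Partition}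
    (hp : p.parts ≠ {n}) {M : Type*} [AddCommGroup M]
    (ρ : Representation ℤ (Equiv.Perm (Fin n)) M) {v : ShapeFacet p → M}
    (hv : LinearIndependent ℤ v) (hρ : ∀ g s, ρ g (v s) = orientationSign g s.1 • v (g • s)) :
    ∃ W : Subrepresentation ρ, W.toSubmodule = Submodule.span ℤ (Set.range v) ∧
      Nonempty (W.toRepresentation.Equiv (inducedRep p)) := by
  refine Representation.exists_subrepresentation_equiv_ind ρ hv
    (fun g s => orientationSign g s.1) (fun g s => orientationSign_mul_self g s.1) hρ
    (youngNormalizer p) (signRep p) ⟨stdFacet p hp, isFacet_stdFacet p hp hn, hasShape_stdFacet p hp⟩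
    (fun s => ?_) (fun g => ?_) (fun g => ?_)
  · obtain ⟨g, hg⟩ := exists_smul_stdFacet_eq p hp hn s.2.1 s.2.2
    exact ⟨g, Subtype.ext hg⟩
  · exact (mem_youngNormalizer_iff p hp g).trans
      ⟨fun h => Subtype.ext h, fun h => congrArg (fun t : ShapeFacet p => t.1) h⟩
  · simp [signRep, orientationSign_stdFacet]

/-- A facet of shape `p` as a chain. -/
def facetChain {p : n.Partition} (s : ShapeFacet p) : chains (complex n) p.parts.card :=
  ⟨Finsupp.single s.1 1, Finsupp.single_mem_supported ℤ _ ⟨s.2.2.card_eq, Or.inr s.2.1.prop⟩⟩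

lemma linearIndependent_facetChain (p : n.Partition) :
    LinearIndependent ℤ (facetChain : ShapeFacet p → _) := by
  refine LinearIndependent.of_comp (chains (complex n) p.parts.card).subtype ?_
  have h := (Finsupp.basisSingleOne (R := ℤ) (ι := Finset (Block n))).linearIndependent.comp
    (fun s : ShapeFacet p => s.1) Subtype.val_injective
  rwa [Finsupp.coe_basisSingleOne] at h

lemma facetSpan_eq (p : n.Partition) :
    facetSpan p = Submodule.span ℤ (Set.range (facetChain : ShapeFacet p → _)) := by
  rw [facetSpan]
  congr 1
  ext c
  constructor
  · rintro ⟨s, hs, hsp, hc⟩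
    exact ⟨⟨s, hs, hsp⟩, Subtype.ext hc.symm⟩
  · rintro ⟨s, rfl⟩
    exact ⟨s.1, s.2.1, s.2.2, rfl⟩

lemma chainRep_facetChain {p : n.Partition} (g : Equiv.Perm (Fin n)) (s : ShapeFacet p) :
    chainRep n p.parts.card g (facetChain s) = orientationSign g s.1 • facetChain (g • s) := by
  refine Subtype.ext ?_
  change action _ _ g (Finsupp.single s.1 1) = orientationSign g s.1 • Finsupp.single (g • s.1) 1
  rw [action_single, Finsupp.smul_single, one_mul, smul_eq_mul, mul_one]

/-- A facet whose shape has no part equal to one, as a homology facet. -/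
def ShapeFacet.toHomologyFacet {q : ℕ} {p : Shape n q} (s : ShapeFacet p.1) : HomologyFacet n q :=
  ⟨s.1, ⟨s.2.1, fun x hx h1 => p.2.2.1 (by
    rw [← s.2.2, Multiset.mem_map]
    exact ⟨x, hx, h1⟩)⟩, s.2.2.card_eq.trans p.2.1⟩

lemma ShapeFacet.toHomologyFacet_injective {q : ℕ} {p : Shape n q} :
    Function.Injective (toHomologyFacet : ShapeFacet p.1 → HomologyFacet n q) :=
  fun _ _ h => Subtype.ext (congrArg (fun t : HomologyFacet n q => t.1) h)

/-- As `p` has no part `1`, every facet of this shape is a homology facet, and its class is the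
corresponding basis element; the order `r` thus disappears from the description. -/
lemma homologyFacetSpan_eq (hn : 2 ≤ n) {r : Finset (Block n) → Finset (Block n) → Prop}
    (hr : IsFacetOrder n r) {q : ℕ} (p : Shape n q) :
    homologyFacetSpan r q p.1 = Submodule.span ℤ
      (Set.range fun s : ShapeFacet p.1 => homologyBasis hn q s.toHomologyFacet) := by
  rw [homologyFacetSpan]
  congr 1
  ext h
  constructor
  · rintro ⟨s, hs, hsp, hh⟩
    let s' : ShapeFacet p.1 := ⟨s, hs.1, hsp⟩
    exact ⟨s', ((isFacetClass_iff hn hr s'.toHomologyFacet h).1 hh).symm⟩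
  · rintro ⟨s, rfl⟩
    exact ⟨s.1, (isHomologyFacet_iff hn hr).2 s.toHomologyFacet.2.1, s.2.2,
      (isFacetClass_iff hn hr s.toHomologyFacet _).2 rfl⟩

/-- The shape of a homology facet. -/
def HomologyFacet.shape {q : ℕ} (s : HomologyFacet n q) : Shape n q :=
  ⟨{ parts := s.1.val.map fun x => x.toFinset.card
     parts_pos := fun hi => by
      obtain ⟨x, -, rfl⟩ := Multiset.mem_map.1 hi
      exact x.toFinset_nonempty.card_pos
     parts_sum := by
      change ∑ x ∈ s.1, x.toFinset.card = n
      rw [← Finset.card_biUnion fun x hx y hy hxy => s.2.1.1.prop.2 x hx y hy hxy]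
      have : s.1.biUnion Block.toFinset = Finset.univ :=
        Finset.eq_univ_iff_forall.2 fun m => Finset.mem_biUnion.2 ((isFacet_iff.1 s.2.1.1).2 m)
      rw [this, Finset.card_univ, Fintype.card_fin] },
    by rw [Multiset.card_map, Finset.card_val, s.2.2],
    fun h => by
      obtain ⟨x, hx, hx1⟩ := Multiset.mem_map.1 h
      exact s.2.1.2 x hx hx1,
    fun h => by
      obtain ⟨x, -, hx⟩ := Multiset.mem_map.1 h
      exact x.2.2 ((Finset.card_eq_iff_eq_univ _).1 (hx.trans (Fintype.card_fin n).symm))⟩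

lemma HomologyFacet.shape_eq_iff {q : ℕ} {s : HomologyFacet n q} {p : Shape n q} :
    s.shape = p ↔ HasShape s.1 p.1 := by
  rw [Subtype.ext_iff, Nat.Partition.ext_iff]
  rfl

/-- The summands are spanned by the fibres of the shape map on `homologyBasis`, and these fibres
partition the basis. -/
lemma isInternal_homologyFacetSpan (hn : 2 ≤ n) {r : Finset (Block n) → Finset (Block n) → Prop}
    (hr : IsFacetOrder n r) (q : ℕ) :
    DirectSum.IsInternal fun p : Shape n q => homologyFacetSpan r q p.1 := by
  have hspan : (fun p : Shape n q => homologyFacetSpan r q p.1) =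
      fun p => Submodule.span ℤ (homologyBasis hn q '' (HomologyFacet.shape ⁻¹' {p})) := by
    funext p
    rw [homologyFacetSpan_eq hn hr]
    congr 1
    ext h
    constructor
    · rintro ⟨s, rfl⟩
      exact ⟨s.toHomologyFacet, HomologyFacet.shape_eq_iff.2 s.2.2, rfl⟩
    · rintro ⟨s, hs, rfl⟩
      exact ⟨⟨s.1, s.2.1.1, HomologyFacet.shape_eq_iff.1 hs⟩, rfl⟩
  rw [hspan]
  exact (homologyBasis hn q).isInternal_span_fibers HomologyFacet.shape

lemma exists_subrepresentation_homologyFacetSpan (hn : 2 ≤ n)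
    {r : Finset (Block n) → Finset (Block n) → Prop} (hr : IsFacetOrder n r) {q : ℕ}
    (p : Shape n q) :
    ∃ W : Subrepresentation (homologyRep n q), W.toSubmodule = homologyFacetSpan r q p.1 ∧
      Nonempty (W.toRepresentation.Equiv (inducedRep p.1)) := by
  rw [homologyFacetSpan_eq hn hr]
  refine exists_subrepresentation_equiv_inducedRep hn
    (fun h => p.2.2.2 (h ▸ Multiset.mem_singleton_self n)) (homologyRep n q)
    ((homologyBasis hn q).linearIndependent.comp _ ShapeFacet.toHomologyFacet_injective)
    fun g s => homologyRep_homologyBasis hn g s.toHomologyFacet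

end MatchingComplex

end
-- The theorem
open MatchingComplex in
theorem theorem3p1 (n : ℕ) (hn : 2 ≤ n)
    (r : Finset (Block n) → Finset (Block n) → Prop) (hr : IsFacetOrder n r) :
    (∀ p : n.Partition, p.parts ≠ {n} →
      ∃ W : Subrepresentation (chainRep n p.parts.card), W.toSubmodule = facetSpan p ∧
        Nonempty (W.toRepresentation.Equiv (inducedRep p))) ∧
    (∀ q : ℕ, ∀ p : Shape n q,
      ∃ W : Subrepresentation (homologyRep n q), W.toSubmodule = homologyFacetSpan r q p.1 ∧
        Nonempty (W.toRepresentation.Equiv (inducedRep p.1))) ∧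
    ∀ q : ℕ,
      DirectSum.IsInternal (fun p : Shape n q => homologyFacetSpan r q p.1) ∧
      Nonempty ((homologyRep n q).Equiv
        (Representation.directSum fun p : Shape n q => inducedRep p.1)) := by
  refine ⟨fun p hp => ?_, fun q p => exists_subrepresentation_homologyFacetSpan hn hr p,
    fun q => ⟨isInternal_homologyFacetSpan hn hr q, ?_⟩⟩
  · rw [facetSpan_eq]
    exact exists_subrepresentation_equiv_inducedRep hn hp _ (linearIndependent_facetChain p)
      chainRep_facetChain
  · choose W hW e using fun p : Shape n q => exists_subrepresentation_homologyFacetSpan hn hr p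
    refine Representation.nonempty_equiv_directSum (homologyRep n q) W ?_ _ fun p => (e p).some
    simp only [hW]
    exact isInternal_homologyFacetSpan hn hr q
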